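/- Let $\mathrm{Vec}$ be the category of complex vector spaces. Let $\mathrm{Vec}^{\Delta}$ be the category whose objects are pairs $(V,L)$ consisting of a finite set $L$ and a complex vector space $V_x$ for each $x\in L$, and in which a morphism $(V,L)\to(V',L')$ consists of a surjection $L'\to L$ together with a linear map $V_x\to\bigotimes_{y\mapsto x}V'_y$ for each $x\in L$. Let $\mathrm{Vec}^f\subset\mathrm{Vec}^{\Delta}$ be the subcategory with the same objects in which the maps $L'\to L$ are bijections. A functor $F\colon\mathrm{Vec}^{\Delta}\to\mathrm{Vec}$ is a $\Delta$-module if, for every finite set $L$, the functor $(V_x)_{x\in L}\mapsto F(V,L)$ is a subquotient of a (possibly infinite) direct sum of functors of the form $(V_x)_{x\in L}\mapsto\bigotimes_{x\in L}V_x^{\otimes d_x}$. A $\Delta$-module is noetherian if every ascending chain of $\Delta$-submodules (subfunctors) stabilizes. It is finitely generated if there are finitely many elements, each belonging to $F(V,L)$ for some $(V,L)$, that are not all contained in any proper $\Delta$-submodule. For a positive integer $n$ let $T_n\colon\mathrm{Vec}^f\to\mathrm{Vec}$ be the functor with $T_n(V,L)=V_x^{\otimes n}$ if $L=\{x\}$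 and $T_n(V,L)=0$ if $\#L\neq1$, and let $\Phi(T_n)$ be the $\Delta$-module given by $\Phi(T_n)(V,L)=\bigotimes_{x\in L}V_x^{\otimes n}$ if $L\neq\emptyset$ and $\Phi(T_n)(V,L)=0$ if $L=\emptyset$. A $\Delta$-module is small if it is isomorphic to a subquotient of a finite direct sum of $\Delta$-modules $\Phi(T_n)$, where the positive integers $n$ may vary. **Theorem.** (a) For every positive integer $n$, $\Phi(T_n)$ is the free $\Delta$-module on $T_n$: for every $\Delta$-module $M$, each natural transformation $T_n\to M|_{\mathrm{Vec}^f}$ extends uniquely along the inclusion $T_n\to\Phi(T_n)|_{\mathrm{Vec}^f}$ to a morphism of $\Delta$-modules $\Phi(T_n)\to M$. Moreover, $\Phi(T_n)$ is a noetherian $\Delta$-module. (b) Every small $\Delta$-module is noetherian and finitely generated. -/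

import Mathlib

open CategoryTheory

open scoped TensorProduct DirectSum

universe u

noncomputable section

set_option linter.unusedSectionVars false
set_option linter.unusedVariables false

namespace DeltaMod

/-! ### Regrouping the factors of a tensor product -/

section Regroup

variable {J : Type} {A : J → Type} {K : Type} (e : (Σ j, A j) ≃ K)
  (M : K → Type u) [∀ k, AddCommGroup (M k)] [∀ k, Module ℂ (M k)]

theorem regroup_update [DecidableEq J] [∀ j, DecidableEq (A j)] [DecidableEq K]
    (m : ∀ k, M k) (j : J) (a : A j) (x : M (e ⟨j, a⟩)) :
    (fun j' => PiTensorProduct.tprod ℂ fun a' => Function.update m (e ⟨j, a⟩) x (e ⟨j', a'⟩)) =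
      Function.update
        (fun j' => PiTensorProduct.tprod ℂ fun a' => m (e ⟨j', a'⟩)) j
        (PiTensorProduct.tprod ℂ (Function.update (fun a' => m (e ⟨j, a'⟩)) a x)) := by
  funext j'
  by_cases hj : j' = j
  · subst hj
    rw [Function.update_self]
    congr 1
    funext a'
    by_cases ha : a' = a
    · subst ha
      simp
    · rw [Function.update_of_ne ha, Function.update_of_ne]
      intro h
      exact ha (by simpa using e.injective h)
  · rw [Function.update_of_ne hj]
    congr 1
    funext a'
    rw [Function.update_of_ne]
    intro h
    exact hj (congrArg Sigma.fst (e.injective h))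

/-- The canonical map `⨂_{k ∈ K} M k → ⨂_{j ∈ J} ⨂_{a ∈ A j} M (e (j, a))` attached to a
bijection `e : (Σ j, A j) ≃ K`; it sends `⨂ m k` to `⨂_j ⨂_a m (e (j, a))`. -/
def split : (⨂[ℂ] k, M k) →ₗ[ℂ] ⨂[ℂ] j, ⨂[ℂ] a, M (e ⟨j, a⟩) :=
  PiTensorProduct.lift
    { toFun := fun m =>
        PiTensorProduct.tprod ℂ fun j => PiTensorProduct.tprod ℂ fun a => m (e ⟨j, a⟩)
      map_update_add' := by
        intro _ m k x y
        classical
        obtain ⟨⟨j, a⟩, rfl⟩ := e.surjective k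
        simp only [regroup_update, MultilinearMap.map_update_add]
      map_update_smul' := by
        intro _ m k c x
        classical
        obtain ⟨⟨j, a⟩, rfl⟩ := e.surjective k
        simp only [regroup_update, MultilinearMap.map_update_smul] }

theorem split_tprod (m : ∀ k, M k) :
    split e M (PiTensorProduct.tprod ℂ m) =
      PiTensorProduct.tprod ℂ fun j => PiTensorProduct.tprod ℂ fun a => m (e ⟨j, a⟩) :=
  PiTensorProduct.lift.tprod m

theorem split_bijective [Finite J] [∀ j, Finite (A j)] [Finite K] :
    Function.Bijective (split e M) := by
  classical
  let b := fun k => Module.Basis.ofVectorSpace ℂ (M k)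
  let B := Basis.piTensorProduct b
  let B' := Basis.piTensorProduct fun j => Basis.piTensorProduct fun a => b (e ⟨j, a⟩)
  let σ : (∀ k, Module.Basis.ofVectorSpaceIndex ℂ (M k)) ≃
      (∀ j, ∀ a, Module.Basis.ofVectorSpaceIndex ℂ (M (e ⟨j, a⟩))) :=
    (Equiv.piCongrLeft (fun k => Module.Basis.ofVectorSpaceIndex ℂ (M k)) e).symm.trans
      (Equiv.piCurry fun j a => Module.Basis.ofVectorSpaceIndex ℂ (M (e ⟨j, a⟩)))
  have h : split e M = (B.equiv B' σ).toLinearMap := by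
    refine B.ext fun p => ?_
    rw [LinearEquiv.coe_coe, Module.Basis.equiv_apply]
    simp only [B, B', Basis.piTensorProduct_apply, split_tprod]
    rfl
  rw [h]
  exact (B.equiv B' σ).bijective

variable [Finite J] [∀ j, Finite (A j)] [Finite K]

/-- The canonical isomorphism of `⨂_{k ∈ K} M k` with `⨂_{j ∈ J} ⨂_{a ∈ A j} M (e (j, a))`. -/
def splitEquiv : (⨂[ℂ] k, M k) ≃ₗ[ℂ] ⨂[ℂ] j, ⨂[ℂ] a, M (e ⟨j, a⟩) :=
  LinearEquiv.ofBijective (split e M) (split_bijective e M)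

/-- The inverse regrouping, which sends `⨂_j ⨂_a m (e (j, a))` to `⨂_k m k`. -/
def join : (⨂[ℂ] j, ⨂[ℂ] a, M (e ⟨j, a⟩)) →ₗ[ℂ] ⨂[ℂ] k, M k :=
  (splitEquiv e M).symm.toLinearMap

theorem splitEquiv_tprod (m : ∀ k, M k) :
    splitEquiv e M (PiTensorProduct.tprod ℂ m) =
      PiTensorProduct.tprod ℂ fun j => PiTensorProduct.tprod ℂ fun a => m (e ⟨j, a⟩) :=
  split_tprod e M m

theorem join_tprod (m : ∀ k, M k) :
    join e M (PiTensorProduct.tprod ℂ fun j => PiTensorProduct.tprod ℂ fun a => m (e ⟨j, a⟩)) =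
      PiTensorProduct.tprod ℂ m := by
  rw [← splitEquiv_tprod]
  exact (splitEquiv e M).symm_apply_apply _

theorem ext_split {N : Type*} [AddCommGroup N] [Module ℂ N]
    {φ ψ : (⨂[ℂ] j, ⨂[ℂ] a, M (e ⟨j, a⟩)) →ₗ[ℂ] N}
    (h : φ ∘ₗ split e M = ψ ∘ₗ split e M) : φ = ψ := by
  refine LinearMap.ext fun t => ?_
  obtain ⟨s, rfl⟩ := (split_bijective e M).2 t
  exact LinearMap.congr_fun h s

theorem map_comp_join (N : K → Type u) [∀ k, AddCommGroup (N k)] [∀ k, Module ℂ (N k)]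
    (h : ∀ k, M k →ₗ[ℂ] N k) :
    PiTensorProduct.map h ∘ₗ join e M =
      join e N ∘ₗ PiTensorProduct.map fun j => PiTensorProduct.map fun a => h (e ⟨j, a⟩) := by
  refine ext_split e M (PiTensorProduct.ext (MultilinearMap.ext fun m => ?_))
  simp only [LinearMap.compMultilinearMap_apply, LinearMap.comp_apply, split_tprod, join_tprod,
    PiTensorProduct.map_tprod]
  exact (join_tprod e N fun k => h k (m k)).symm

end Regroup

/-! ### Regrouping along the fibres of maps of finite sets -/

section Fibre

variable {X Y Z W : Type} (f : Y → X) (g : Z → Y) (h : W → Z)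

/-- The fibre of `f ∘ g` over `x` is the union of the fibres of `g` over the fibre of `f`. -/
@[simps]
def fibreEquiv (x : X) :
    (Σ y : {y // f y = x}, {z // g z = y.1}) ≃ {z // f (g z) = x} where
  toFun p := ⟨p.2.1, by rw [p.2.2, p.1.2]⟩
  invFun z := ⟨⟨g z.1, z.2⟩, ⟨z.1, rfl⟩⟩
  left_inv := by
    rintro ⟨⟨y, hy⟩, ⟨z, hz⟩⟩
    change g z = y at hz
    subst y
    rfl
  right_inv _ := rfl

variable [Finite X] [Finite Y] [Finite Z] [Finite W]

/-- The canonical map `⨂_{f (g z) = x} M z → ⨂_{f y = x} ⨂_{g z = y} M z`. -/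
def fibreSplit (M : Z → Type u) [∀ z, AddCommGroup (M z)] [∀ z, Module ℂ (M z)] (x : X) :
    (⨂[ℂ] z : {z // f (g z) = x}, M z.1) →ₗ[ℂ]
      ⨂[ℂ] y : {y // f y = x}, ⨂[ℂ] z : {z // g z = y.1}, M z.1 :=
  split (fibreEquiv f g x) (fun z => M z.1)

/-- The canonical map `⨂_y M y → ⨂_x ⨂_{f y = x} M y`. -/
def totalSplit (M : Y → Type u) [∀ y, AddCommGroup (M y)] [∀ y, Module ℂ (M y)] :
    (⨂[ℂ] y, M y) →ₗ[ℂ] ⨂[ℂ] x, ⨂[ℂ] y : {y // f y = x}, M y.1 :=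
  split (Equiv.sigmaFiberEquiv f) M

/-- The inverse canonical map `⨂_{f y = x} ⨂_{g z = y} M z → ⨂_{f (g z) = x} M z`. -/
def fibreJoin (M : Z → Type u) [∀ z, AddCommGroup (M z)] [∀ z, Module ℂ (M z)] (x : X) :
    (⨂[ℂ] y : {y // f y = x}, ⨂[ℂ] z : {z // g z = y.1}, M z.1) →ₗ[ℂ]
      ⨂[ℂ] z : {z // f (g z) = x}, M z.1 :=
  join (fibreEquiv f g x) (fun z => M z.1)

/-- The inverse canonical map `⨂_x ⨂_{f y = x} M y → ⨂_y M y`. -/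
def totalJoin (M : Y → Type u) [∀ y, AddCommGroup (M y)] [∀ y, Module ℂ (M y)] :
    (⨂[ℂ] x, ⨂[ℂ] y : {y // f y = x}, M y.1) →ₗ[ℂ] ⨂[ℂ] y, M y :=
  join (Equiv.sigmaFiberEquiv f) M

/-- The canonical isomorphism of a vector space with the tensor product of the one-element family
of vector spaces consisting of it. -/
def single (M : X → Type u) [∀ y, AddCommGroup (M y)] [∀ y, Module ℂ (M y)] (x : X) :
    M x →ₗ[ℂ] ⨂[ℂ] y : {y // y = x}, M y.1 :=
  haveI : DecidableEq {y // y = x} := Classical.decEq _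
  (PiTensorProduct.tprod ℂ (s := fun y : {y // y = x} => M y.1)).toLinearMap 0 ⟨x, rfl⟩

section

variable (M : Z → Type u) [∀ z, AddCommGroup (M z)] [∀ z, Module ℂ (M z)]
  (N : Z → Type u) [∀ z, AddCommGroup (N z)] [∀ z, Module ℂ (N z)]

theorem fibreSplit_tprod (x : X) (m : ∀ z : {z // f (g z) = x}, M z.1) :
    fibreSplit f g M x (PiTensorProduct.tprod ℂ m) =
      PiTensorProduct.tprod ℂ fun y : {y // f y = x} =>
        PiTensorProduct.tprod ℂ fun z : {z // g z = y.1} => m ⟨z.1, (congrArg f z.2).trans y.2⟩ :=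
  split_tprod (fibreEquiv f g x) (fun z => M z.1) m

theorem totalSplit_tprod (m : ∀ z, M z) :
    totalSplit g M (PiTensorProduct.tprod ℂ m) =
      PiTensorProduct.tprod ℂ fun y => PiTensorProduct.tprod ℂ fun z : {z // g z = y} => m z.1 :=
  split_tprod (Equiv.sigmaFiberEquiv g) M m

theorem fibreJoin_tprod (x : X) (m : ∀ z : {z // f (g z) = x}, M z.1) :
    fibreJoin f g M x (PiTensorProduct.tprod ℂ fun y : {y // f y = x} =>
      PiTensorProduct.tprod ℂ fun z : {z // g z = y.1} => m ⟨z.1, (congrArg f z.2).trans y.2⟩) = PiTensorProduct.tprod ℂ m :=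
  join_tprod (fibreEquiv f g x) (fun z => M z.1) m

theorem totalJoin_tprod (m : ∀ z, M z) :
    totalJoin g M (PiTensorProduct.tprod ℂ fun y =>
      PiTensorProduct.tprod ℂ fun z : {z // g z = y} => m z.1) =
      PiTensorProduct.tprod ℂ m :=
  join_tprod (Equiv.sigmaFiberEquiv g) M m

theorem fibre_ext {P : Type u} [AddCommGroup P] [Module ℂ P] (x : X)
    {φ ψ : (⨂[ℂ] y : {y // f y = x}, ⨂[ℂ] z : {z // g z = y.1}, M z.1) →ₗ[ℂ] P}
    (h : φ ∘ₗ fibreSplit f g M x = ψ ∘ₗ fibreSplit f g M x) : φ = ψ :=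
  ext_split (fibreEquiv f g x) (fun z => M z.1) h

theorem total_ext {P : Type u} [AddCommGroup P] [Module ℂ P]
    {φ ψ : (⨂[ℂ] y, ⨂[ℂ] z : {z // g z = y}, M z.1) →ₗ[ℂ] P}
    (h : φ ∘ₗ totalSplit g M = ψ ∘ₗ totalSplit g M) : φ = ψ :=
  ext_split (Equiv.sigmaFiberEquiv g) M h

theorem single_apply (x : Z) (m : ∀ y : {y // y = x}, M y.1) :
    single M x (m ⟨x, rfl⟩) = PiTensorProduct.tprod ℂ m := by
  rw [single, MultilinearMap.toLinearMap_apply]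
  congr 1
  funext y
  obtain ⟨y, rfl⟩ := y
  simp

theorem map_comp_fibreJoin (φ : ∀ z, M z →ₗ[ℂ] N z) (x : X) :
    PiTensorProduct.map (fun z : {z // f (g z) = x} => φ z.1) ∘ₗ fibreJoin f g M x =
      fibreJoin f g N x ∘ₗ
        PiTensorProduct.map fun _ => PiTensorProduct.map fun z => φ z.1 :=
  map_comp_join (fibreEquiv f g x) _ _ _

theorem map_comp_totalJoin (φ : ∀ z, M z →ₗ[ℂ] N z) :
    PiTensorProduct.map φ ∘ₗ totalJoin g M =
      totalJoin g N ∘ₗ PiTensorProduct.map fun _ => PiTensorProduct.map fun z => φ z.1 :=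
  map_comp_join (Equiv.sigmaFiberEquiv g) _ _ _

end

variable (M : W → Type u) [∀ z, AddCommGroup (M z)] [∀ z, Module ℂ (M z)]

theorem fibreJoin_fibreJoin (x : X) :
    fibreJoin (fun z => f (g z)) h M x ∘ₗ
        fibreJoin f g (fun z => ⨂[ℂ] w : {w // h w = z}, M w.1) x =
      fibreJoin f (fun w => g (h w)) M x ∘ₗ
        PiTensorProduct.map fun y => fibreJoin g h M y.1 := by
  refine fibre_ext f g (fun z => ⨂[ℂ] w : {w // h w = z}, M w.1) x ?_
  refine fibre_ext (fun z => f (g z)) h M x ?_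
  refine PiTensorProduct.ext (MultilinearMap.ext fun m => ?_)
  simp only [LinearMap.compMultilinearMap_apply, LinearMap.comp_apply]
  rw [fibreSplit_tprod, fibreSplit_tprod f g (fun z => ⨂[ℂ] w : {w // h w = z}, M w.1),
    PiTensorProduct.map_tprod]
  refine (congrArg _ (fibreJoin_tprod f g (fun z => ⨂[ℂ] w : {w // h w = z}, M w.1) x
    (fun z => PiTensorProduct.tprod ℂ fun w : {w // h w = z.1} =>
      m ⟨w.1, (congrArg (fun z => f (g z)) w.2).trans z.2⟩))).trans ?_
  rw [fibreJoin_tprod (fun z => f (g z)) h M x m]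
  refine (fibreJoin_tprod f (fun w => g (h w)) M x m).symm.trans ?_
  congr 2
  funext y
  exact (fibreJoin_tprod g h M y.1 fun w => m ⟨w.1, (congrArg f w.2).trans y.2⟩).symm

theorem totalJoin_totalJoin :
    totalJoin h M ∘ₗ totalJoin g (fun z => ⨂[ℂ] w : {w // h w = z}, M w.1) =
      totalJoin (fun w => g (h w)) M ∘ₗ PiTensorProduct.map fun y => fibreJoin g h M y := by
  refine total_ext g (fun z => ⨂[ℂ] w : {w // h w = z}, M w.1) ?_
  refine total_ext h M ?_
  refine PiTensorProduct.ext (MultilinearMap.ext fun m => ?_)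
  simp only [LinearMap.compMultilinearMap_apply, LinearMap.comp_apply]
  rw [totalSplit_tprod, totalSplit_tprod g (fun z => ⨂[ℂ] w : {w // h w = z}, M w.1),
    PiTensorProduct.map_tprod]
  rw [totalJoin_tprod g (fun z => ⨂[ℂ] w : {w // h w = z}, M w.1)
    (fun z => PiTensorProduct.tprod ℂ fun w => m w.1)]
  rw [totalJoin_tprod h M m]
  refine (totalJoin_tprod (fun w => g (h w)) M m).symm.trans ?_
  congr 2
  funext y
  exact (fibreJoin_tprod g h M y fun w => m w.1).symm

theorem fibreJoin_single_left (x : Z) (t : ⨂[ℂ] w : {w // h w = x}, M w.1)  :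
    fibreJoin (fun z : Z => z) h M x
      (single (fun z => ⨂[ℂ] w : {w // h w = z}, M w.1) x t) = t := by
  refine LinearMap.congr_fun (f := fibreJoin (fun z : Z => z) h M x ∘ₗ
    single (fun z => ⨂[ℂ] w : {w // h w = z}, M w.1) x) (g := LinearMap.id) ?_ t
  refine PiTensorProduct.ext (MultilinearMap.ext fun m => ?_)
  simp only [LinearMap.compMultilinearMap_apply, LinearMap.comp_apply]
  refine (congrArg _ (single_apply (fun z => ⨂[ℂ] w : {w // h w = z}, M w.1) x
    fun y => PiTensorProduct.tprod ℂ fun w => m ⟨w.1, w.2.trans y.2⟩)).trans ?_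
  exact fibreJoin_tprod (fun z : Z => z) h M x m

theorem map_single (x : Z) {N : Z → Type u} [∀ z, AddCommGroup (N z)] [∀ z, Module ℂ (N z)]
    {M : Z → Type u} [∀ z, AddCommGroup (M z)] [∀ z, Module ℂ (M z)]
    (φ : ∀ z, M z →ₗ[ℂ] N z) (v : M x) :
    PiTensorProduct.map (fun z : {z // z = x} => φ z.1) (single M x v) =
      single N x (φ x v) := by
  have h₁ := single_apply M x fun y => y.2.symm.rec (motive := fun a _ => M a) v
  have h₂ := single_apply N x fun y => φ y.1 (y.2.symm.rec (motive := fun a _ => M a) v)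
  refine (congrArg _ h₁).trans ?_
  refine Eq.trans ?_ h₂.symm
  rw [PiTensorProduct.map_tprod]

theorem fibreJoin_map_single (x : Z) (t : ⨂[ℂ] w : {w // h w = x}, M w.1) :
    fibreJoin h (fun w : W => w) M x
      (PiTensorProduct.map (fun w : {w // h w = x} => single M w.1) t) = t := by
  refine LinearMap.congr_fun (f := fibreJoin h (fun w : W => w) M x ∘ₗ
    PiTensorProduct.map (fun w : {w // h w = x} => single M w.1)) (g := LinearMap.id) ?_ t
  refine PiTensorProduct.ext (MultilinearMap.ext fun m => ?_)
  simp only [LinearMap.compMultilinearMap_apply, LinearMap.comp_apply, PiTensorProduct.map_tprod]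
  refine Eq.trans ?_ (fibreJoin_tprod h (fun w : W => w) M x m)
  congr 2
  funext y
  exact single_apply M y.1 fun w => m ⟨w.1, by rw [w.2, y.2]⟩

theorem totalJoin_map_single (t : ⨂[ℂ] w, M w) :
    totalJoin (fun w : W => w) M (PiTensorProduct.map (fun w => single M w) t) = t := by
  refine LinearMap.congr_fun (f := totalJoin (fun w : W => w) M ∘ₗ
    PiTensorProduct.map (fun w => single M w)) (g := LinearMap.id) ?_ t
  refine PiTensorProduct.ext (MultilinearMap.ext fun m => ?_)
  simp only [LinearMap.compMultilinearMap_apply, LinearMap.comp_apply, PiTensorProduct.map_tprod]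
  refine Eq.trans ?_ (totalJoin_tprod (fun w : W => w) M m)
  congr 2
  funext y
  exact single_apply M y fun w => m w.1

end Fibre

/-! ### Interchanging the factors of an iterated tensor product -/

section Swap

variable {L : Type} [Finite L] (n : ℕ)
  (M : L → Type u) [∀ x, AddCommGroup (M x)] [∀ x, Module ℂ (M x)]
  (N : L → Type u) [∀ x, AddCommGroup (N x)] [∀ x, Module ℂ (N x)]

/-- The canonical isomorphism `⨂_{(x, i)} M x ≃ ⨂_x ⨂_i M x`. -/
def swapLeft : (⨂[ℂ] p : L × Fin n, M p.1) ≃ₗ[ℂ] ⨂[ℂ] x, ⨂[ℂ] _ : Fin n, M x :=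
  splitEquiv (Equiv.sigmaEquivProd L (Fin n)) (fun p => M p.1)

/-- The canonical isomorphism `⨂_{(x, i)} M x ≃ ⨂_i ⨂_x M x`. -/
def swapRight : (⨂[ℂ] p : L × Fin n, M p.1) ≃ₗ[ℂ] ⨂[ℂ] _ : Fin n, ⨂[ℂ] x, M x :=
  splitEquiv ((Equiv.sigmaEquivProd (Fin n) L).trans (Equiv.prodComm (Fin n) L))
    (fun p => M p.1)

/-- The canonical isomorphism `⨂_x (M x)^{⊗ n} ≃ (⨂_x M x)^{⊗ n}`. -/
def swap : (⨂[ℂ] x, ⨂[ℂ] _ : Fin n, M x) ≃ₗ[ℂ] ⨂[ℂ] _ : Fin n, ⨂[ℂ] x, M x :=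
  (swapLeft n M).symm.trans (swapRight n M)

theorem swapLeft_tprod (m : ∀ p : L × Fin n, M p.1) :
    swapLeft n M (PiTensorProduct.tprod ℂ m) =
      PiTensorProduct.tprod ℂ fun x => PiTensorProduct.tprod ℂ fun i => m (x, i) :=
  splitEquiv_tprod (Equiv.sigmaEquivProd L (Fin n)) (fun p => M p.1) m

theorem swapRight_tprod (m : ∀ p : L × Fin n, M p.1) :
    swapRight n M (PiTensorProduct.tprod ℂ m) =
      PiTensorProduct.tprod ℂ fun i => PiTensorProduct.tprod ℂ fun x => m (x, i) :=
  splitEquiv_tprod ((Equiv.sigmaEquivProd (Fin n) L).trans (Equiv.prodComm (Fin n) L))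
    (fun p => M p.1) m

theorem swap_swapLeft (t : ⨂[ℂ] p : L × Fin n, M p.1) :
    swap n M (swapLeft n M t) = swapRight n M t := by
  simp [swap]

theorem swap_map (φ : ∀ x, M x →ₗ[ℂ] N x) (t : ⨂[ℂ] x, ⨂[ℂ] _ : Fin n, M x) :
    swap n N (PiTensorProduct.map (fun x => PiTensorProduct.map fun _ => φ x) t) =
      PiTensorProduct.map (fun _ => PiTensorProduct.map φ) (swap n M t) := by
  obtain ⟨t, rfl⟩ := (swapLeft n M).surjective t
  refine LinearMap.congr_fun
    (f := (swap n N).toLinearMap ∘ₗ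
      PiTensorProduct.map (fun x => PiTensorProduct.map fun _ => φ x) ∘ₗ
        (swapLeft n M).toLinearMap)
    (g := PiTensorProduct.map (fun _ => PiTensorProduct.map φ) ∘ₗ (swap n M).toLinearMap ∘ₗ
      (swapLeft n M).toLinearMap) ?_ t
  refine PiTensorProduct.ext (MultilinearMap.ext fun m => ?_)
  simp only [LinearMap.compMultilinearMap_apply, LinearMap.comp_apply, LinearEquiv.coe_coe]
  rw [swap_swapLeft, swapRight_tprod, swapLeft_tprod]
  simp only [PiTensorProduct.map_tprod]
  have h := swapLeft_tprod n N fun p => φ p.1 (m p)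
  rw [← h, swap_swapLeft, swapRight_tprod]

end Swap

/-! ### The category of families of vector spaces -/

/-- An object `(V, L)`: a finite set `L` and a complex vector space `V x` for every `x ∈ L`. -/
structure VecDelta where
  /-- the finite index set -/
  L : Type
  /-- the members of the family -/
  V : L → ModuleCat.{u} ℂ
  [fin : Finite L]

attribute [instance] VecDelta.fin

/-- A morphism `(V, L) → (V', L')`: a surjection `L' → L` together with a linear map from `V x` to
the tensor product of the `V' y` with `y ↦ x`, for every `x ∈ L`. -/
structure VecDelta.Hom (X Y : VecDelta.{u}) where
  /-- the underlying map of index sets -/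
  toFun : Y.L → X.L
  surjective : Function.Surjective toFun
  /-- the linear maps -/
  maps : ∀ x, X.V x →ₗ[ℂ] ⨂[ℂ] y : {y // toFun y = x}, Y.V y.1

/-- Composition applies the linear maps of the second morphism to the tensor factors. -/
instance : Category VecDelta.{u} where
  Hom := VecDelta.Hom
  id X := ⟨fun x => x, Function.surjective_id, fun x => single (fun x => X.V x) x⟩
  comp {X Y Z} f g := ⟨fun z => f.toFun (g.toFun z), f.surjective.comp g.surjective, fun x =>
    fibreJoin f.toFun g.toFun (fun z => Z.V z) x ∘ₗ
      PiTensorProduct.map (fun y : {y // f.toFun y = x} => g.maps y.1) ∘ₗ f.maps x⟩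
  id_comp {X Y} f := by
    obtain ⟨f, hf, φ⟩ := f
    refine congrArg (VecDelta.Hom.mk f hf) (funext fun x => LinearMap.ext fun v => ?_)
    simp only [LinearMap.comp_apply]
    erw [map_single x φ v]
    exact fibreJoin_single_left f (fun y => Y.V y) x (φ x v)
  comp_id {X Y} f := by
    obtain ⟨f, hf, φ⟩ := f
    refine congrArg (VecDelta.Hom.mk f hf) (funext fun x => LinearMap.ext fun v => ?_)
    exact fibreJoin_map_single f (fun y => Y.V y) x (φ x v)
  assoc {X Y Z W} f g h := by
    obtain ⟨f, hf, φ⟩ := f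
    obtain ⟨g, hg, ψ⟩ := g
    obtain ⟨h, hh, χ⟩ := h
    refine congrArg (VecDelta.Hom.mk (fun w => f (g (h w))) _)
      (funext fun x => LinearMap.ext fun v => ?_)
    have h₁ := LinearMap.congr_fun (map_comp_fibreJoin f g (fun z => Z.V z)
      (fun z => ⨂[ℂ] w : {w // h w = z}, W.V w.1) χ x)
      (PiTensorProduct.map (fun y : {y // f y = x} => ψ y.1) (φ x v))
    have h₂ := LinearMap.congr_fun (fibreJoin_fibreJoin f g h (fun w => W.V w) x)
      (PiTensorProduct.map (fun _ => PiTensorProduct.map fun z => χ z.1)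
        (PiTensorProduct.map (fun y : {y // f y = x} => ψ y.1) (φ x v)))
    refine ((congrArg (fibreJoin (fun z => f (g z)) h (fun w => W.V w) x) h₁).trans h₂).trans ?_
    simp only [LinearMap.comp_apply, PiTensorProduct.map_comp]

/-- The linear map `⨂_x V x → ⨂_y V' y` induced by a morphism `(V, L) → (V', L')`. -/
def totalMap {X Y : VecDelta.{u}} (f : X ⟶ Y) : (⨂[ℂ] x, X.V x) →ₗ[ℂ] ⨂[ℂ] y, Y.V y :=
  totalJoin f.toFun (fun y => Y.V y) ∘ₗ PiTensorProduct.map f.maps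

theorem totalMap_id (X : VecDelta.{u}) : totalMap (𝟙 X) = LinearMap.id :=
  LinearMap.ext fun t => totalJoin_map_single (fun x => X.V x) t

theorem totalMap_comp {X Y Z : VecDelta.{u}} (f : X ⟶ Y) (g : Y ⟶ Z) :
    totalMap (f ≫ g) = totalMap g ∘ₗ totalMap f := by
  refine LinearMap.ext fun t => ?_
  have h₁ := LinearMap.congr_fun (map_comp_totalJoin f.toFun (fun y => Y.V y)
    (fun y => ⨂[ℂ] z : {z // g.toFun z = y}, Z.V z.1) g.maps)
    (PiTensorProduct.map f.maps t)
  have h₂ := LinearMap.congr_fun (totalJoin_totalJoin f.toFun g.toFun (fun z => Z.V z))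
    (PiTensorProduct.map (fun x => PiTensorProduct.map fun y : {y // f.toFun y = x} =>
      g.maps y.1) (PiTensorProduct.map f.maps t))
  refine Eq.trans ?_ ((congrArg (totalJoin g.toFun (fun z => Z.V z)) h₁).trans h₂).symm
  change totalJoin _ _ (PiTensorProduct.map _ t) = totalJoin _ _ _
  refine congrArg _ ?_
  simp only [← LinearMap.comp_apply, ← PiTensorProduct.map_comp]
  rfl

/-- The linear map `⨂_x (V x)^{⊗ n} → ⨂_y (V' y)^{⊗ n}` induced by a morphism: the `n`-th tensor
power of `⨂_x V x → ⨂_y V' y`, transported along `⨂_x (V x)^{⊗ n} ≃ (⨂_x V x)^{⊗ n}`. -/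
def tensorMap (n : ℕ) {X Y : VecDelta.{u}} (f : X ⟶ Y) :
    (⨂[ℂ] x, ⨂[ℂ] _ : Fin n, X.V x) →ₗ[ℂ] ⨂[ℂ] y, ⨂[ℂ] _ : Fin n, Y.V y :=
  (swap n fun y => Y.V y).symm.toLinearMap ∘ₗ
    PiTensorProduct.map (fun _ => totalMap f) ∘ₗ (swap n fun x => X.V x).toLinearMap

/-- The functor `(V, L) ↦ ⨂_{x ∈ L} (V x)^{⊗ n}`. -/
def tensorW (n : ℕ) : VecDelta.{u} ⥤ ModuleCat.{u} ℂ where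
  obj X := ModuleCat.of ℂ (⨂[ℂ] x, ⨂[ℂ] _ : Fin n, X.V x)
  map f := ModuleCat.ofHom (tensorMap n f)
  map_id X := by
    refine ModuleCat.hom_ext (LinearMap.ext fun (t : ⨂[ℂ] x, ⨂[ℂ] _ : Fin n, X.V x) => ?_)
    change tensorMap n (𝟙 X) t = t
    simp only [tensorMap, totalMap_id, PiTensorProduct.map_id, LinearMap.comp_apply,
      LinearEquiv.coe_coe, LinearMap.id_apply, LinearEquiv.symm_apply_apply]
  map_comp {X Y Z} f g := by
    refine ModuleCat.hom_ext (LinearMap.ext fun (t : ⨂[ℂ] x, ⨂[ℂ] _ : Fin n, X.V x) => ?_)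
    change tensorMap n (f ≫ g) t = tensorMap n g (tensorMap n f t)
    simp only [tensorMap, totalMap_comp, PiTensorProduct.map_comp, LinearMap.comp_apply,
      LinearEquiv.coe_coe, LinearEquiv.apply_symm_apply]

/-- The morphisms whose underlying map of index sets is bijective. -/
def isoOnIndex : MorphismProperty VecDelta.{u} := fun _ _ f => Function.Bijective f.toFun

instance : isoOnIndex.{u}.IsMultiplicative where
  id_mem _ := Function.bijective_id
  comp_mem _ _ hf hg := hf.comp hg

/-- The category of finite families of vector spaces: a morphism `(V, L) → (V', L')` is a bijection
`L' → L` and a linear map `V x → V' y` whenever `y ↦ x` (a tensor product over a one-element set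
being identified with its only factor). -/
abbrev VecF := WideSubcategory isoOnIndex.{u}

/-- The inclusion of the category of finite families. -/
abbrev inclF : VecF.{u} ⥤ VecDelta.{u} := wideSubcategoryInclusion isoOnIndex

/-- The functor sending a family `(V x)_{x ∈ L}` with fixed index set to the object `(V, L)`. -/
def family (L : Type) [Finite L] : (L → ModuleCat.{u} ℂ) ⥤ VecDelta.{u} where
  obj V := ⟨L, V⟩
  map {V V'} f := ⟨fun x => x, Function.surjective_id, fun x =>
    single (fun x => V' x) x ∘ₗ (f x).hom⟩
  map_id V := rfl
  map_comp {V V' V''} f g := by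
    refine congrArg (VecDelta.Hom.mk (X := ⟨L, V⟩) (Y := ⟨L, V''⟩) (fun x => x)
      Function.surjective_id)
      (funext fun x => LinearMap.ext fun v => ?_)
    simp only [LinearMap.comp_apply]
    erw [map_single (M := fun x => V' x) (N := fun x => ⨂[ℂ] y : {y // y = x}, V'' y.1) x
      (fun x => single (fun x => V'' x) x ∘ₗ (g x).hom) ((f x).hom v)]
    exact (fibreJoin_single_left (fun y : L => y) (fun y => V'' y) x
      (single (fun x => V'' x) x ((g x).hom ((f x).hom v)))).symm

/-! ### Functors to vector spaces -/

section Functors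

variable {C : Type*} [Category C]

/-- A subfunctor of a functor to vector spaces. -/
@[ext]
structure Sub (F : C ⥤ ModuleCat.{u} ℂ) where
  /-- the subspaces -/
  obj : ∀ X, Submodule ℂ (F.obj X)
  map_mem : ∀ {X Y} (f : X ⟶ Y), ∀ t ∈ obj X, (F.map f).hom t ∈ obj Y

instance (F : C ⥤ ModuleCat.{u} ℂ) : PartialOrder (Sub F) :=
  PartialOrder.lift Sub.obj fun _ _ => Sub.ext

/-- A subfunctor, regarded as a functor. -/
def Sub.toFunctor {F : C ⥤ ModuleCat.{u} ℂ} (S : Sub F) : C ⥤ ModuleCat.{u} ℂ where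
  obj X := ModuleCat.of ℂ (S.obj X)
  map f := ModuleCat.ofHom ((F.map f).hom.restrict (S.map_mem f))
  map_id X := by
    refine ModuleCat.hom_ext (LinearMap.ext fun t => Subtype.ext ?_)
    simp
  map_comp f g := by
    refine ModuleCat.hom_ext (LinearMap.ext fun t => Subtype.ext ?_)
    simp

/-- The inclusion of a subfunctor. -/
def Sub.incl {F : C ⥤ ModuleCat.{u} ℂ} (S : Sub F) : S.toFunctor ⟶ F where
  app X := ModuleCat.ofHom (S.obj X).subtype

/-- The smallest subfunctor that contains a given set of elements. -/
def Sub.span {F : C ⥤ ModuleCat.{u} ℂ} (S : Set (Σ X, F.obj X)) : Sub F where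
  obj X := ⨅ N : {N : Sub F // ∀ s ∈ S, s.2 ∈ N.obj s.1}, N.1.obj X
  map_mem f t ht := by
    simp only [Submodule.mem_iInf] at ht ⊢
    exact fun N => N.1.map_mem f t (ht N)

/-- `F` is a subquotient of `G`, that is, a quotient of a functor which embeds into `G`. -/
def IsSubquotient (F G : C ⥤ ModuleCat.{u} ℂ) : Prop :=
  ∃ (H : C ⥤ ModuleCat.{u} ℂ) (i : H ⟶ G) (p : H ⟶ F),
    (∀ X, Function.Injective (i.app X).hom) ∧ (∀ X, Function.Surjective (p.app X).hom)

/-- The direct sum of a family of functors. -/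
def directSum {I : Type u} (F : I → C ⥤ ModuleCat.{u} ℂ) : C ⥤ ModuleCat.{u} ℂ where
  obj X := ModuleCat.of ℂ (⨁ i, (F i).obj X)
  map f := ModuleCat.ofHom (DirectSum.lmap fun i => ((F i).map f).hom)
  map_id X := by
    refine ModuleCat.hom_ext (LinearMap.ext fun t => ?_)
    simp
  map_comp f g := by
    refine ModuleCat.hom_ext (LinearMap.ext fun t => ?_)
    simp

end Functors

/-- The functor `(V x)_{x ∈ L} ↦ ⨂_{x ∈ L} (V x)^{⊗ d x}`. -/
def monomial {L : Type} (d : L → ℕ) : (L → ModuleCat.{u} ℂ) ⥤ ModuleCat.{u} ℂ where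
  obj V := ModuleCat.of ℂ (⨂[ℂ] x, ⨂[ℂ] _ : Fin (d x), V x)
  map f := ModuleCat.ofHom (PiTensorProduct.map fun x => PiTensorProduct.map fun _ => (f x).hom)
  map_id V := by
    refine ModuleCat.hom_ext (LinearMap.ext fun t => ?_)
    simp
  map_comp f g := by
    refine ModuleCat.hom_ext (LinearMap.ext fun t => ?_)
    simp [PiTensorProduct.map_comp]

/-- A functor of several vector spaces is nice if it is a subquotient of a (possibly infinite)
direct sum of functors of the form `(V x)_{x ∈ L} ↦ ⨂_{x ∈ L} (V x)^{⊗ d x}`. -/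
def IsNice {L : Type} (F : (L → ModuleCat.{u} ℂ) ⥤ ModuleCat.{u} ℂ) : Prop :=
  ∃ (I : Type u) (d : I → L → ℕ), IsSubquotient F (directSum fun i => monomial (d i))

end DeltaMod

open DeltaMod in
/-- A `Δ`-module: a functor from `VecDelta` to vector spaces that is nice as a functor of the
members of the family, for every finite index set. -/
structure DeltaModule where
  /-- the underlying functor -/
  functor : VecDelta.{u} ⥤ ModuleCat.{u} ℂ
  nice : ∀ (L : Type) [Finite L], IsNice (family L ⋙ functor)

namespace DeltaModule

open DeltaMod

/-- The `Δ`-submodules of `F`. (A subfunctor of a nice functor is nice.) -/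
abbrev Submod (F : DeltaModule.{u}) := Sub F.functor

/-- Every ascending chain of `Δ`-submodules stabilizes. -/
def IsNoetherian (F : DeltaModule.{u}) : Prop :=
  ∀ M : ℕ →o F.Submod, ∃ N, ∀ m, N ≤ m → M m = M N

/-- Some finite set of elements, each taken from `F (V, L)` for some `(V, L)`, is contained in no
`Δ`-submodule other than `F` itself. -/
def IsFinitelyGenerated (F : DeltaModule.{u}) : Prop :=
  ∃ S : Set (Σ X, F.functor.obj X), S.Finite ∧ ∀ X, (Sub.span S).obj X = ⊤

/-- `η` exhibits `F` as the free `Δ`-module on `T`: maps of functors on the category of finite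
families from `T` to a `Δ`-module extend uniquely along `η` to maps of `Δ`-modules from `F`. -/
def IsFreeOn (F : DeltaModule.{u}) (T : VecF.{u} ⥤ ModuleCat.{u} ℂ)
    (η : T ⟶ inclF ⋙ F.functor) : Prop :=
  ∀ (M : DeltaModule.{u}) (φ : T ⟶ inclF ⋙ M.functor),
    ∃! ψ : F.functor ⟶ M.functor, η ≫ Functor.whiskerLeft inclF ψ = φ

open Classical in
/-- The object `T_n`, given by `(V, L) ↦ (V x)^{⊗ n}` if `L = {x}` and `0` if `L` does not have
exactly one element. -/
def T (n : ℕ) : VecF.{u} ⥤ ModuleCat.{u} ℂ :=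
  Sub.toFunctor (F := inclF ⋙ tensorW n)
    { obj := fun X => if Nat.card X.obj.L = 1 then ⊤ else ⊥
      map_mem := by
        intro X Y f t ht
        by_cases h : Nat.card X.obj.L = 1
        · have h' : Nat.card Y.obj.L = 1 := (Nat.card_eq_of_bijective _ f.property).trans h
          rw [if_pos h']
          exact Submodule.mem_top
        · rw [if_neg h, Submodule.mem_bot] at ht
          rw [ht, map_zero]
          exact Submodule.zero_mem _ }

open Classical in
/-- The subfunctor of `(V, L) ↦ ⨂_{x ∈ L} (V x)^{⊗ n}` that is everything for nonempty `L` and `0`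
for empty `L`. -/
def phiSub (n : ℕ) : Sub (tensorW.{u} n) where
  obj X := if Nonempty X.L then ⊤ else ⊥
  map_mem := by
    intro X Y f t ht
    by_cases h : Nonempty X.L
    · have h' : Nonempty Y.L := h.map fun x => (f.surjective x).choose
      rw [if_pos h']
      exact Submodule.mem_top
    · rw [if_neg h, Submodule.mem_bot] at ht
      rw [ht, map_zero]
      exact Submodule.zero_mem _

theorem tensorMap_family (n : ℕ) {L : Type} [Finite L] {V V' : L → ModuleCat.{u} ℂ} (f : V ⟶ V')
    (t : ⨂[ℂ] x, ⨂[ℂ] _ : Fin n, V x) :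
    tensorMap n ((family L).map f) t =
      PiTensorProduct.map (fun x => PiTensorProduct.map fun _ => (f x).hom) t := by
  have h : totalMap ((family L).map f) = PiTensorProduct.map fun x => (f x).hom := by
    refine LinearMap.ext fun (t : ⨂[ℂ] x, V x) => ?_
    refine Eq.trans ?_ (totalJoin_map_single (fun x => V' x)
      (PiTensorProduct.map (fun x => (f x).hom) t))
    rw [← LinearMap.comp_apply (PiTensorProduct.map _), ← PiTensorProduct.map_comp]
    rfl
  have h' := swap_map n (fun x => V x) (fun x => V' x) (fun x => (f x).hom) t
  refine (congrArg (fun φ => (swap n fun x => V' x).symm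
    (PiTensorProduct.map (fun _ => φ) (swap n (fun x => V x) t))) h).trans ?_
  exact (LinearEquiv.symm_apply_eq _).2 h'.symm

/-- The `Δ`-module `Φ(T_n)`, given by `(V, L) ↦ ⨂_{x ∈ L} (V x)^{⊗ n}` if `L` is nonempty and `0`
if `L` is empty. -/
def Phi (n : ℕ) : DeltaModule.{u} where
  functor := (phiSub n).toFunctor
  nice L _ := by
    refine ⟨PUnit, fun _ _ => n, family L ⋙ (phiSub n).toFunctor,
      { app := fun V => ModuleCat.ofHom
          (DirectSum.lof ℂ PUnit.{u+1}
            (fun _ => (monomial fun _ : L => n).obj V) PUnit.unit ∘ₗ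
            ((phiSub n).obj ((family L).obj V)).subtype)
        naturality := ?_ }, 𝟙 _, ?_, ?_⟩
    · intro V V' f
      refine ModuleCat.hom_ext (LinearMap.ext fun t => ?_)
      refine (congrArg (DirectSum.lof ℂ PUnit.{u+1}
        (fun _ => (monomial fun _ : L => n).obj V') PUnit.unit)
          (tensorMap_family n f t.1)).trans ?_
      exact (DirectSum.lmap_lof (fun _ : PUnit.{u+1} => ((monomial fun _ : L => n).map f).hom)
        PUnit.unit t.1).symm
    · intro V
      exact (DirectSum.of_injective (β := fun _ : PUnit.{u+1} =>
        (monomial fun _ : L => n).obj V) PUnit.unit).comp Subtype.val_injective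
    · intro V t
      exact ⟨t, rfl⟩

/-- The canonical map `T_n → Φ(T_n)`: the identity of `(V x)^{⊗ n}` if `L = {x}`. -/
def unit (n : ℕ) : T.{u} n ⟶ inclF ⋙ (Phi.{u} n).functor where
  app X := ModuleCat.ofHom (Submodule.inclusion (by
    simp only [phiSub]
    split_ifs with h₁ h₂
    · exact le_rfl
    · exact absurd (Nat.card_pos_iff.1 (h₁ ▸ Nat.one_pos)).1 h₂
    all_goals exact bot_le))

/-- A `Δ`-module is small if it is a subquotient of a finite direct sum of modules `Φ(T_n)` with
`n` positive, where `n` may vary. -/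
def IsSmall (F : DeltaModule.{u}) : Prop :=
  ∃ (I : Type u) (_ : Finite I) (n : I → ℕ), (∀ i, 0 < n i) ∧
    IsSubquotient F.functor (directSum fun i => (Phi (n i)).functor)

end DeltaModule

end

/-!
The extension property of `Φ(T_n)` holds because every nonempty family `(V, L)` receives a morphism
`collapse` from the one-member family `⨂_x V x`, and `Φ(T_n)` sends it to the isomorphism
`(⨂_x V x)^{⊗ n} ≃ ⨂_x (V x)^{⊗ n}` (`isIso_fromTotal`). A map out of `Φ(T_n)` is therefore
determined by its values on one-member families, where it is the given map from `T_n`; conversely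
these values define a map because `collapse` is natural (`collapse_naturality`).

For the chain condition, let `N` be a subfunctor of `(V, L) ↦ ⨂_x (V x)^{⊗ n}`. Its multilinear
part on `L` is the space of those functions `c` on the families `σ` of permutations of `Fin n`
indexed by `L` for which `∑ σ, c σ • ⨂_x ⨂_i v x (σ x i)` always lies in `N`. By polarization,
which uses characteristic zero, `N` is determined by its multilinear parts
(`le_of_multilinearPart_le`). They are stable under pullback along surjections `L' → L`
(`mapDomain_mem_multilinearPart`). On `L = Fin m` they consist of linear combinations of words of
length `m` over the finite alphabet of permutations, and a Gröbner basis argument applies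
(`chain_stabilizes_of_surjective_pullback`): ordered surjections preserve the lexicographic order,
and Higman's lemma shows that words are well-quasi-ordered under pullback along ordered surjections
(`exists_lt_isOrderedSurjection`).

The chain condition passes to finite direct sums and subquotients, and it implies finite generation.
-/

/-! ### Words over a finite alphabet and ordered surjections -/

/-- A map `f : Fin m' → Fin m` is an ordered surjection if it is onto and the first preimages of
`0, 1, 2, …` appear in this order. This is encoded as: every `i` has a preimage `j` before which
`f` takes only values smaller than `i`. -/
def IsOrderedSurjection {m m' : ℕ} (f : Fin m' → Fin m) : Prop :=
  ∀ i, ∃ j, f j = i ∧ ∀ j' < j, f j' < i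

theorem IsOrderedSurjection.surjective {m m' : ℕ} {f : Fin m' → Fin m}
    (hf : IsOrderedSurjection f) : Function.Surjective f :=
  fun i => (hf i).imp fun _ h => h.1

/-- Pulling back words along an ordered surjection preserves the lexicographic order: the first
place where `w ∘ f` and `w' ∘ f` differ is the first preimage of the first place where `w` and
`w'` differ. -/
theorem IsOrderedSurjection.strictMono_comp {G : Type*} [LinearOrder G] {m m' : ℕ}
    {f : Fin m' → Fin m} (hf : IsOrderedSurjection f) {w w' : Fin m → G}
    (h : toLex w < toLex w') : toLex (w ∘ f) < toLex (w' ∘ f) := by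
  obtain ⟨i, hi, hlt⟩ := h
  obtain ⟨j, rfl, hj⟩ := hf i
  exact ⟨j, fun j' hj' => hi _ (hj j' hj'), hlt⟩

/-- Higman's lemma for the subword order on a finite alphabet. -/
theorem wellQuasiOrdered_sublist (A : Type*) [Finite A] :
    WellQuasiOrdered (List.Sublist : List A → List A → Prop) := by
  have h := Set.PartiallyWellOrderedOn.partiallyWellOrderedOn_sublistForall₂ (α := A) (· = ·)
    (s := Set.univ)
    (Set.partiallyWellOrderedOn_of_wellQuasiOrdered (Finite.wellQuasiOrdered _) _)
  simp only [Set.mem_univ, implies_true, Set.ofPred_true,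
    Set.partiallyWellOrderedOn_univ_iff] at h
  intro f
  obtain ⟨a, b, hab, hs⟩ := h f
  rw [List.sublistForall₂_iff] at hs
  obtain ⟨l, hl, hs⟩ := hs
  rw [List.forall₂_eq_eq_eq] at hl
  exact ⟨a, b, hab, hl ▸ hs⟩

section Words

variable {G : Type*}

open Classical in
/-- A word, with a mark at every letter that tells whether the letter has occurred before. -/
noncomputable def markedWord {m : ℕ} (w : Fin m → G) : List (G × Bool) :=
  List.ofFn fun i => (w i, decide (∃ j < i, w j = w i))

theorem exists_first_occurrence {m : ℕ} (w : Fin m → G) {a : G} (ha : a ∈ Set.range w) :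
    ∃ i, w i = a ∧ ∀ j < i, w j ≠ a := by
  obtain ⟨i, hi, hmin⟩ := WellFounded.has_min wellFounded_lt {i | w i = a} ha
  exact ⟨i, hi, fun j hj h => hmin j h hj⟩

/-- If two words use the same letters and one marked word is a subword of the other, then the
second word is the pullback of the first along an ordered surjection. The positions of the subword
go back to where they come from, and every other position goes to the first occurrence of its
letter. Since first occurrences match first occurrences, the map is ordered. -/
theorem exists_isOrderedSurjection {m m' : ℕ} {w : Fin m → G} {w' : Fin m' → G}
    (hr : Set.range w = Set.range w') (hs : (markedWord w).Sublist (markedWord w')) :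
    ∃ f : Fin m' → Fin m, IsOrderedSurjection f ∧ w' = w ∘ f := by
  classical
  obtain ⟨φ₀, hφ₀⟩ := List.sublist_iff_exists_fin_orderEmbedding_get_eq.1 hs
  obtain ⟨φ, hφ⟩ : ∃ φ : Fin m ↪o Fin m', ∀ i, w i = w' (φ i) ∧
      ((∃ j < i, w j = w i) ↔ ∃ j < φ i, w' j = w' (φ i)) := by
    have e (k : ℕ) (u : Fin k → G) : (markedWord u).length = k := by simp [markedWord]
    refine ⟨(Fin.castOrderIso (e m w)).symm.toOrderEmbedding.trans
      (φ₀.trans (Fin.castOrderIso (e m' w')).toOrderEmbedding), fun i => ?_⟩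
    have h := hφ₀ (Fin.cast (e m w).symm i)
    simp only [markedWord, List.get_ofFn, Prod.mk.injEq, decide_eq_decide] at h
    exact h
  choose first hfirst hmin using fun j => exists_first_occurrence w
    (hr ▸ Set.mem_range_self j : w' j ∈ Set.range w)
  let f : Fin m' → Fin m := fun j => if h : ∃ i, φ i = j then h.choose else first j
  have hf (i) : f (φ i) = i := by
    have h : ∃ i', φ i' = φ i := ⟨i, rfl⟩
    simp only [f, dif_pos h]
    exact φ.injective h.choose_spec
  refine ⟨f, fun i => ⟨φ i, hf i, fun j hj => ?_⟩, funext fun j => ?_⟩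
  · by_cases h : ∃ i', φ i' = j
    · obtain ⟨i', rfl⟩ := h
      rw [hf]
      exact φ.lt_iff_lt.1 hj
    · simp only [f, dif_neg h]
      refine φ.lt_iff_lt.1 (lt_of_le_of_lt (not_lt.1 fun hlt => ?_) hj)
      obtain ⟨i', hi', he⟩ := (hφ (first j)).2.2 ⟨j, hlt, by rw [← (hφ _).1, hfirst]⟩
      exact hmin j i' hi' (he.trans (hfirst j))
  · by_cases h : ∃ i', φ i' = j
    · obtain ⟨i', rfl⟩ := h
      rw [Function.comp_apply, hf, (hφ i').1]
    · simp only [Function.comp_apply, f, dif_neg h, hfirst]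

/-- Words over a finite alphabet are well-quasi-ordered by pullback along ordered surjections. -/
theorem exists_lt_isOrderedSurjection [Finite G] (m : ℕ → ℕ) (w : ∀ k, Fin (m k) → G) :
    ∃ k l, k < l ∧ ∃ f : Fin (m l) → Fin (m k), IsOrderedSurjection f ∧ w l = w k ∘ f := by
  obtain ⟨k, l, hkl, hr, hs⟩ := (Finite.wellQuasiOrdered (Eq : Set G → Set G → Prop)).prod
    (wellQuasiOrdered_sublist (G × Bool)) fun k => (Set.range (w k), markedWord (w k))
  exact ⟨k, l, hkl, exists_isOrderedSurjection hr hs⟩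

/-- A Gröbner basis argument. If the chain does not stabilize, choose infinitely many jumps of it
and, at each of them, a new element whose leading word is smallest possible. Two of the leading
words are related by an ordered surjection, and the pullback of the earlier element lies in the
chain before the later jump; subtracting a multiple of it gives a new element with a smaller
leading word. -/
theorem chain_stabilizes_of_surjective_pullback {k : Type*} [Field k] [Finite G]
    (U : ℕ → ∀ m, Submodule k ((Fin m → G) →₀ k)) (hmono : ∀ m, Monotone fun r => U r m)
    (hU : ∀ r {m m'} (f : Fin m' → Fin m), Function.Surjective f → ∀ c ∈ U r m,
      Finsupp.mapDomain (fun w => w ∘ f) c ∈ U r m') :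
    ∃ r, ∀ s, r ≤ s → ∀ m, U s m = U r m := by
  classical
  let _ : LinearOrder G := LinearOrder.lift' (Finite.equivFin G) (Finite.equivFin G).injective
  by_contra! hne
  have hjump (r : ℕ) : ∃ s, r ≤ s ∧ ∃ (m : ℕ) (c : (Fin m → G) →₀ k) (w : Fin m → G),
      c ∈ U s m ∧ c ∉ U r m ∧ c w ≠ 0 ∧ (∀ w', c w' ≠ 0 → toLex w' ≤ toLex w) ∧
      ∀ c' ∈ U s m, (∀ w', c' w' ≠ 0 → toLex w' < toLex w) → c' ∈ U r m := by
    obtain ⟨s, hrs, m, hm⟩ := hne r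
    obtain ⟨c₀, hc₀, hc₀'⟩ := SetLike.exists_of_lt (lt_of_le_of_ne (hmono m hrs) hm.symm)
    have hlead {c : (Fin m → G) →₀ k} (hc : c ∉ U r m) :
        ∃ w, c w ≠ 0 ∧ ∀ w', c w' ≠ 0 → toLex w' ≤ toLex w := by
      have h : c.support.Nonempty := by
        rw [Finsupp.support_nonempty_iff]
        rintro rfl
        exact hc (zero_mem _)
      obtain ⟨w, hw, hmax⟩ := Finset.exists_max_image c.support toLex h
      exact ⟨w, by simpa using hw, fun w' hw' => hmax w' (by simpa using hw')⟩
    obtain ⟨w₀, hw₀, hw₀'⟩ := hlead hc₀'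
    obtain ⟨x, ⟨c, hc, hc', hx, hx'⟩, hmin⟩ := WellFounded.has_min
      (wellFounded_lt (α := Lex (Fin m → G)))
      {x | ∃ c ∈ U s m, c ∉ U r m ∧ c (ofLex x) ≠ 0 ∧ ∀ w', c w' ≠ 0 → toLex w' ≤ x}
      ⟨toLex w₀, c₀, hc₀, hc₀', hw₀, hw₀'⟩
    refine ⟨s, hrs, m, c, ofLex x, hc, hc', hx, hx', fun c' hcs hlt => ?_⟩
    by_contra hcr
    obtain ⟨w, hw, hw'⟩ := hlead hcr
    exact hmin (toLex w) ⟨c', hcs, hcr, hw, hw'⟩ (hlt w hw)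
  choose next hnext m c w hc hc' hw hw' hmin using hjump
  let R : ℕ → ℕ := fun i => next^[i] 0
  have hR (i) : R (i + 1) = next (R i) := Function.iterate_succ_apply' next i 0
  have hRmono : Monotone R := monotone_nat_of_le_succ fun i => (hR i).symm ▸ hnext (R i)
  obtain ⟨i, j, hij, f, hf, he⟩ := exists_lt_isOrderedSurjection
    (fun i => m (R i)) (fun i => w (R i))
  -- `d` is the pullback of the earlier element; its leading word is that of the later one
  let d := Finsupp.mapDomain (fun w => w ∘ f) (c (R i))
  have hinj : Function.Injective fun w : Fin (m (R i)) → G => w ∘ f :=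
    hf.surjective.injective_comp_right
  have hd : d ∈ U (R j) (m (R j)) :=
    hmono _ (hRmono (Nat.succ_le_of_lt hij))
      (by simpa only [hR] using hU _ f hf.surjective _ (hc (R i)))
  have hdw : d (w (R j)) = c (R i) (w (R i)) := by
    rw [he]
    exact Finsupp.mapDomain_apply hinj _ _
  have hdlt (w') (h : d w' ≠ 0) : toLex w' ≤ toLex (w (R j)) := by
    by_cases hr : w' ∈ Set.range fun w : Fin (m (R i)) → G => w ∘ f
    · obtain ⟨v, rfl⟩ := hr
      rw [Finsupp.mapDomain_apply hinj] at h
      rw [he]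
      rcases (hw' (R i) v h).lt_or_eq with h | h
      · exact (hf.strictMono_comp h).le
      · exact (congrArg (fun v => toLex (ofLex v ∘ f)) h).le
    · exact absurd (Finsupp.mapDomain_of_notMem_range _ _ hr) h
  let a := c (R j) (w (R j)) / c (R i) (w (R i))
  refine hc' (R j) ?_
  have hsub : c (R j) - a • d ∈ U (R j) (m (R j)) := by
    refine hmin (R j) _ (sub_mem (hc _) (Submodule.smul_mem _ _ (hmono _ (hnext _) hd))) ?_
    intro w' h
    refine lt_of_le_of_ne ?_ ?_
    · by_contra hlt
      refine h ?_
      rw [Finsupp.sub_apply, Finsupp.smul_apply, not_imp_comm.1 (hw' (R j) w') hlt,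
        not_imp_comm.1 (hdlt w') hlt, smul_zero, sub_zero]
    · intro h'
      obtain rfl : w' = w (R j) := toLex.injective h'
      refine h ?_
      rw [Finsupp.sub_apply, Finsupp.smul_apply, hdw, smul_eq_mul, div_mul_cancel₀ _ (hw _),
        sub_self]
  simpa using add_mem hsub (Submodule.smul_mem _ a hd)

end Words

/-! ### Subfunctors and chain conditions -/

namespace DeltaMod

section Chains

variable {C : Type*} [Category C]

/-- Every ascending chain of subfunctors stabilizes. -/
def ChainCondition (F : C ⥤ ModuleCat.{u} ℂ) : Prop :=
  ∀ M : ℕ →o Sub F, ∃ r, ∀ s, r ≤ s → M s = M r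

/-- The image of a subfunctor under a natural transformation. -/
def Sub.map {F G : C ⥤ ModuleCat.{u} ℂ} (η : F ⟶ G) (S : Sub F) : Sub G where
  obj X := (S.obj X).map (η.app X).hom
  map_mem {X Y} f := by
    rintro _ ⟨t, ht, rfl⟩
    refine ⟨(F.map f).hom t, S.map_mem f t ht, ?_⟩
    exact LinearMap.congr_fun (congrArg ModuleCat.Hom.hom (η.naturality f)) t

/-- The preimage of a subfunctor under a natural transformation. -/
def Sub.comap {F G : C ⥤ ModuleCat.{u} ℂ} (η : F ⟶ G) (S : Sub G) : Sub F where
  obj X := (S.obj X).comap (η.app X).hom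
  map_mem {X Y} f t ht := by
    have h := LinearMap.congr_fun (congrArg ModuleCat.Hom.hom (η.naturality f)) t
    rw [Submodule.mem_comap] at ht ⊢
    exact Eq.mpr (congrArg (· ∈ S.obj Y) h) (S.map_mem f _ ht)

theorem Sub.map_mono {F G : C ⥤ ModuleCat.{u} ℂ} (η : F ⟶ G) : Monotone (Sub.map η) :=
  fun _ _ h X => Submodule.map_mono (h X)

theorem Sub.comap_mono {F G : C ⥤ ModuleCat.{u} ℂ} (η : F ⟶ G) : Monotone (Sub.comap η) :=
  fun _ _ h X => Submodule.comap_mono (h X)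

theorem ChainCondition.of_injective {F G : C ⥤ ModuleCat.{u} ℂ} (hG : ChainCondition G)
    (η : F ⟶ G) (hη : ∀ X, Function.Injective (η.app X).hom) : ChainCondition F := by
  intro M
  obtain ⟨r, hr⟩ := hG ((⟨Sub.map η, Sub.map_mono η⟩ : Sub F →o Sub G).comp M)
  refine ⟨r, fun s hs => Sub.ext (funext fun X => ?_)⟩
  exact Submodule.map_injective_of_injective (hη X) (congrArg (fun S => S.obj X) (hr s hs))

theorem ChainCondition.of_surjective {F G : C ⥤ ModuleCat.{u} ℂ} (hG : ChainCondition G)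
    (η : G ⟶ F) (hη : ∀ X, Function.Surjective (η.app X).hom) : ChainCondition F := by
  intro M
  obtain ⟨r, hr⟩ := hG ((⟨Sub.comap η, Sub.comap_mono η⟩ : Sub F →o Sub G).comp M)
  refine ⟨r, fun s hs => Sub.ext (funext fun X => ?_)⟩
  exact Submodule.comap_injective_of_surjective (hη X) (congrArg (fun S => S.obj X) (hr s hs))

theorem ChainCondition.of_isSubquotient {F G : C ⥤ ModuleCat.{u} ℂ} (hG : ChainCondition G)
    (h : IsSubquotient F G) : ChainCondition F := by
  obtain ⟨H, i, p, hi, hp⟩ := h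
  exact (hG.of_injective i hi).of_surjective p hp

/-- The projection of a direct sum of functors to one of the summands. -/
def directSumProj {I : Type u} (F : I → C ⥤ ModuleCat.{u} ℂ) (i : I) : directSum F ⟶ F i where
  app X := ModuleCat.ofHom (DirectSum.component ℂ I (fun i => (F i).obj X) i)
  naturality X Y f := by
    refine ModuleCat.hom_ext (LinearMap.ext fun t => ?_)
    exact DirectSum.lmap_apply (fun i => ((F i).map f).hom) t i

/-- The part of a direct sum of functors whose components outside `J` vanish. -/
def directSumSupported {I : Type u} (F : I → C ⥤ ModuleCat.{u} ℂ) (J : Set I) :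
    Sub (directSum F) where
  obj X := ⨅ i ∈ Jᶜ, LinearMap.ker ((directSumProj F i).app X).hom
  map_mem {X Y} f t ht := by
    simp only [Submodule.mem_iInf, LinearMap.mem_ker] at ht ⊢
    intro i hi
    have h := LinearMap.congr_fun (congrArg ModuleCat.Hom.hom ((directSumProj F i).naturality f)) t
    refine h.trans ?_
    exact (congrArg ((F i).map f).hom (ht i hi)).trans (map_zero _)

theorem mem_directSumSupported {I : Type u} (F : I → C ⥤ ModuleCat.{u} ℂ) (J : Set I) (X : C)
    (t : (directSum F).obj X) :
    t ∈ (directSumSupported F J).obj X ↔ ∀ i ∉ J, ((directSumProj F i).app X).hom t = 0 := by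
  simp [directSumSupported, Submodule.mem_iInf]

/-- The intersection of two subfunctors. -/
def Sub.inter {F : C ⥤ ModuleCat.{u} ℂ} (S S' : Sub F) : Sub F where
  obj X := S.obj X ⊓ S'.obj X
  map_mem f t ht := ⟨S.map_mem f t ht.1, S'.map_mem f t ht.2⟩

/-- Chains in a finite direct sum stabilize, by induction on the number of summands: a chain is
controlled by its projection to one summand and its intersection with the others. -/
theorem ChainCondition.directSum {I : Type u} [Finite I] (F : I → C ⥤ ModuleCat.{u} ℂ)
    (hF : ∀ i, ChainCondition (F i)) : ChainCondition (directSum F) := by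
  classical
  have key (J : Finset I) : ∀ M : ℕ →o Sub (DeltaMod.directSum F),
      (∀ r, M r ≤ directSumSupported F J) → ∃ r, ∀ s, r ≤ s → M s = M r := by
    induction J using Finset.induction_on with
    | empty =>
      intro M hM
      have h0 (r : ℕ) (X : C) : (M r).obj X = ⊥ := by
        refine eq_bot_iff.2 fun t ht => ?_
        have h := (mem_directSumSupported F _ X t).1 (hM r X ht)
        exact DFinsupp.ext fun i => h i (by simp)
      exact ⟨0, fun s _ => Sub.ext (funext fun X => (h0 s X).trans (h0 0 X).symm)⟩
    | insert i J hi ih =>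
      intro M hM
      obtain ⟨r₁, hr₁⟩ := hF i
        ((⟨Sub.map (directSumProj F i), Sub.map_mono _⟩ : Sub _ →o Sub _).comp M)
      obtain ⟨r₂, hr₂⟩ := ih ((⟨fun S => S.inter (directSumSupported F J),
        fun _ _ h X => inf_le_inf_right _ (h X)⟩ : Sub _ →o Sub _).comp M)
        fun r X => inf_le_right
      refine ⟨max r₁ r₂, fun s hs => le_antisymm (fun X t ht => ?_) (M.monotone hs)⟩
      have h₁ : ((directSumProj F i).app X).hom t ∈
          ((M r₁).map (directSumProj F i)).obj X := by
        have := congrArg (fun S => S.obj X) (hr₁ s ((le_max_left _ _).trans hs))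
        exact this ▸ Submodule.mem_map_of_mem ht
      obtain ⟨t', ht', he⟩ := h₁
      have hle₁ := M.monotone (le_max_left r₁ r₂) X ht'
      have hd : t - t' ∈ ((M s).inter (directSumSupported F J)).obj X := by
        refine ⟨sub_mem ht (M.monotone hs X hle₁), (mem_directSumSupported F _ X _).2 ?_⟩
        intro j hj
        by_cases hji : j = i
        · subst hji
          rw [map_sub, he, sub_self]
        · have hj' : j ∉ (↑(insert i J) : Set I) := by simp_all
          rw [map_sub, (mem_directSumSupported F _ X _).1 (hM s X ht) j hj',
            (mem_directSumSupported F _ X _).1 (hM r₁ X ht') j hj', sub_self]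
      have h₂ : t - t' ∈ (M r₂).obj X := by
        have := congrArg (fun S => S.obj X) (hr₂ s ((le_max_right _ _).trans hs))
        exact (this ▸ hd : t - t' ∈ ((M r₂).inter (directSumSupported F J)).obj X).1
      simpa using add_mem (M.monotone (le_max_right r₁ r₂) X h₂) hle₁
  intro M
  have := Fintype.ofFinite I
  exact key Finset.univ M fun r X t _ =>
    (mem_directSumSupported F _ X t).2 fun i hi => absurd (Finset.mem_coe.2 (Finset.mem_univ i)) hi

theorem Sub.mem_span {F : C ⥤ ModuleCat.{u} ℂ} {S : Set (Σ X, F.obj X)} {s : Σ X, F.obj X}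
    (hs : s ∈ S) : s.2 ∈ (Sub.span S).obj s.1 := by
  simp only [Sub.span, Submodule.mem_iInf]
  exact fun N => N.2 s hs

theorem Sub.span_mono {F : C ⥤ ModuleCat.{u} ℂ} {S S' : Set (Σ X, F.obj X)} (h : S ⊆ S') :
    Sub.span S ≤ Sub.span S' := by
  intro X t ht
  simp only [Sub.span, Submodule.mem_iInf] at ht ⊢
  exact fun N => ht ⟨N.1, fun s hs => N.2 s (h hs)⟩

/-- The chain condition implies finite generation: if no finite set generated `F`, adding one
missing element at a time would give a chain that does not stabilize. -/
theorem ChainCondition.exists_finite_span {F : C ⥤ ModuleCat.{u} ℂ} (hF : ChainCondition F) :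
    ∃ S : Set (Σ X, F.obj X), S.Finite ∧ ∀ X, (Sub.span S).obj X = ⊤ := by
  classical
  by_contra! h
  have hmiss (S : Finset (Σ X, F.obj X)) :
      ∃ s : Σ X, F.obj X, s.2 ∉ (Sub.span (S : Set (Σ X, F.obj X))).obj s.1 := by
    obtain ⟨X, hX⟩ := h S S.finite_toSet
    obtain ⟨t, -, ht⟩ := SetLike.exists_of_lt (lt_top_iff_ne_top.2 hX)
    exact ⟨⟨X, t⟩, ht⟩
  choose s hs using hmiss
  let S : ℕ → Finset (Σ X, F.obj X) := fun r => (fun S => insert (s S) S)^[r] ∅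
  have hS (r) : S (r + 1) = insert (s (S r)) (S r) := Function.iterate_succ_apply' _ r ∅
  have hmono : Monotone S := monotone_nat_of_le_succ fun r => by
    rw [hS]
    exact Finset.subset_insert _ _
  obtain ⟨r, hr⟩ := hF ⟨fun r => Sub.span (S r : Set (Σ X, F.obj X)),
    fun _ _ h => Sub.span_mono (Finset.coe_subset.2 (hmono h))⟩
  refine hs (S r) ?_
  have := congrArg (fun N => N.obj (s (S r)).1) (hr (r + 1) (Nat.le_succ r))
  refine this ▸ Sub.mem_span ?_
  rw [hS]
  exact Finset.mem_coe.2 (Finset.mem_insert_self _ _)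

end Chains

end DeltaMod

/-! ### Multilinear elements of subfunctors of tensor powers -/

namespace DeltaMod

/-- The pure tensor `⨂_x ⨂_i v x i`. -/
noncomputable def pureTensor (n : ℕ) {L : Type} (V : L → ModuleCat.{u} ℂ)
    (v : ∀ x, Fin n → V x) : ⨂[ℂ] x, ⨂[ℂ] _ : Fin n, V x :=
  PiTensorProduct.tprod ℂ fun x => PiTensorProduct.tprod ℂ (v x)

theorem swap_pureTensor {n : ℕ} {L : Type} [Finite L] (V : L → ModuleCat.{u} ℂ)
    (v : ∀ x, Fin n → V x) :
    swap n (fun x => V x) (pureTensor n V v) =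
      PiTensorProduct.tprod ℂ fun i => PiTensorProduct.tprod ℂ fun x => v x i := by
  rw [pureTensor, ← swapLeft_tprod n (fun x => V x) fun p => v p.1 p.2, swap_swapLeft,
    swapRight_tprod]

theorem tensorMap_pureTensor {n : ℕ} {X Y : VecDelta.{u}} (f : X ⟶ Y)
    (v : ∀ x, Fin n → X.V x) (w : ∀ y, Fin n → Y.V y)
    (h : ∀ x i, f.maps x (v x i) =
      PiTensorProduct.tprod ℂ fun y : {y // f.toFun y = x} => w y.1 i) :
    tensorMap n f (pureTensor n X.V v) = pureTensor n Y.V w := by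
  rw [tensorMap, LinearMap.comp_apply, LinearMap.comp_apply, LinearEquiv.coe_coe,
    LinearEquiv.coe_coe, LinearEquiv.symm_apply_eq, swap_pureTensor, swap_pureTensor,
    PiTensorProduct.map_tprod]
  congr 1
  funext i
  rw [totalMap, LinearMap.comp_apply, PiTensorProduct.map_tprod]
  simp only [h]
  exact totalJoin_tprod f.toFun (fun y => Y.V y) fun y => w y i

/-- The linear maps `⨂_x (V x)^{⊗ n} → ⨂_x (V' x)^{⊗ n}` induced by linear maps `V x → V' x`
preserve subfunctors. -/
theorem map_mem_of_sub {n : ℕ} (N : Sub (tensorW.{u} n)) {L : Type} [Finite L]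
    {V V' : L → ModuleCat.{u} ℂ} (φ : ∀ x, V x →ₗ[ℂ] V' x) {t : ⨂[ℂ] x, ⨂[ℂ] _ : Fin n, V x}
    (ht : t ∈ N.obj ⟨L, V⟩) :
    PiTensorProduct.map (fun x => PiTensorProduct.map fun _ => φ x) t ∈ N.obj ⟨L, V'⟩ := by
  have h := N.map_mem ((family L).map (fun x => ModuleCat.ofHom (φ x) : V ⟶ V')) t ht
  have he := DeltaModule.tensorMap_family n (fun x => ModuleCat.ofHom (φ x) : V ⟶ V') t
  exact (congrArg (· ∈ N.obj ⟨L, V'⟩) he).mp h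

/-- The coefficients `c` such that `∑ σ, c σ • ⨂_x ⨂_i v x (σ x i)` belongs to `N` for all vectors
`v x i`, where `σ` runs over the families of permutations of `Fin n` indexed by `L`. This is the
part of `N` that is linear in each `v x i`. -/
noncomputable def multilinearPart {n : ℕ} (N : Sub (tensorW.{u} n)) (L : Type) [Finite L] :
    Submodule ℂ ((L → Equiv.Perm (Fin n)) →₀ ℂ) :=
  ⨅ (V : L → ModuleCat.{u} ℂ) (v : ∀ x, Fin n → V x),
    Submodule.comap (Finsupp.linearCombination ℂ fun σ : L → Equiv.Perm (Fin n) =>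
      pureTensor n V fun x i => v x (σ x i)) (N.obj ⟨L, V⟩)

theorem mem_multilinearPart {n : ℕ} {N : Sub (tensorW.{u} n)} {L : Type} [Finite L]
    {c : (L → Equiv.Perm (Fin n)) →₀ ℂ} :
    c ∈ multilinearPart N L ↔ ∀ (V : L → ModuleCat.{u} ℂ) (v : ∀ x, Fin n → V x),
      Finsupp.linearCombination ℂ (fun σ : L → Equiv.Perm (Fin n) =>
        pureTensor n V fun x i => v x (σ x i)) c ∈ N.obj ⟨L, V⟩ := by
  simp only [multilinearPart, Submodule.mem_iInf]
  rfl

theorem multilinearPart_mono {n : ℕ} (L : Type) [Finite L] :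
    Monotone fun N : Sub (tensorW.{u} n) => multilinearPart N L :=
  fun _ _ h _ hc => mem_multilinearPart.2 fun V v => h _ (mem_multilinearPart.1 hc V v)

/-- Multilinear parts are preserved by pullback along surjections `f`. To see this, apply the
morphism over `f` from the family of the tensor products `⨂_{f y = x} V y` that consists of the
identity maps. -/
theorem mapDomain_mem_multilinearPart {n : ℕ} {N : Sub (tensorW.{u} n)} {L L' : Type} [Finite L]
    [Finite L'] {f : L' → L} (hf : Function.Surjective f) {c : (L → Equiv.Perm (Fin n)) →₀ ℂ}
    (hc : c ∈ multilinearPart N L) :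
    Finsupp.mapDomain (fun σ => σ ∘ f) c ∈ multilinearPart N L' := by
  refine mem_multilinearPart.2 fun V v => ?_
  let W : L → ModuleCat.{u} ℂ := fun x => ModuleCat.of ℂ (⨂[ℂ] y : {y // f y = x}, V y.1)
  let F : (⟨L, W⟩ : VecDelta.{u}) ⟶ ⟨L', V⟩ := ⟨f, hf, fun x => LinearMap.id⟩
  have h := N.map_mem F _ (mem_multilinearPart.1 hc W fun x i =>
    PiTensorProduct.tprod ℂ fun y : {y // f y = x} => v y.1 i)
  refine (congrArg (· ∈ N.obj ⟨L', V⟩) ?_).mp h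
  change tensorMap n F _ = _
  rw [Finsupp.linearCombination_mapDomain, Finsupp.apply_linearCombination]
  congr 2
  funext σ
  refine tensorMap_pureTensor F _ _ fun x i => ?_
  change (PiTensorProduct.tprod ℂ fun y : {y // f y = x} => v y.1 (σ x i)) =
    PiTensorProduct.tprod ℂ fun y : {y // f y = x} => v y.1 (σ (f y.1) i)
  congr 1
  funext y
  rw [y.2]

/-- Inclusion-exclusion: the signed number of sets that contain `I`. -/
theorem sum_neg_one_pow_card_compl {K : Type*} [Fintype K] [DecidableEq K] (I : Finset K) :
    ∑ S : Finset K, (if I ⊆ S then (-1 : ℂ) ^ Sᶜ.card else 0) =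
      if I = Finset.univ then 1 else 0 := by
  have h := Finset.prod_add (fun _ : K => (1 : ℂ)) (fun k => if k ∈ I then 0 else -1) Finset.univ
  have hl : ∏ k : K, ((1 : ℂ) + if k ∈ I then 0 else -1) = if I = Finset.univ then 1 else 0 := by
    split_ifs with hI
    · simp [hI]
    · obtain ⟨k, hk⟩ : ∃ k, k ∉ I := by simpa [Finset.eq_univ_iff_forall] using hI
      exact Finset.prod_eq_zero (Finset.mem_univ k) (by simp [hk])
  rw [← hl, h, Finset.powerset_univ]
  refine Finset.sum_congr rfl fun S _ => ?_
  rw [Finset.prod_const_one, one_mul, ← Finset.compl_eq_univ_sdiff]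
  split_ifs with hI
  · refine (Finset.prod_eq_pow_card fun k hk => ?_).symm
    rw [if_neg fun h => Finset.mem_compl.1 hk (hI h)]
  · obtain ⟨k, hk, hk'⟩ := Finset.not_subset.1 hI
    exact Eq.symm (Finset.prod_eq_zero (f := fun k => if k ∈ I then (0 : ℂ) else -1)
      (Finset.mem_compl.2 hk') (if_pos hk))

/-- Expansion of a tensor of sums of scalar multiples. -/
theorem pureTensor_sum {n : ℕ} {L : Type} [Fintype L] [DecidableEq L] (V : L → ModuleCat.{u} ℂ)
    (a : L → Fin n → Fin n → ℂ) (v : ∀ x, Fin n → V x) :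
    pureTensor n V (fun x i => ∑ k, a x i k • v x k) =
      ∑ r : L → Fin n → Fin n, (∏ x, ∏ i, a x i (r x i)) • pureTensor n V fun x i => v x (r x i) := by
  simp only [pureTensor, MultilinearMap.map_sum, MultilinearMap.map_smul_univ]

end DeltaMod

/-! ### Polarization -/

namespace DeltaMod

/-- The basis of `⨂_x (V x)^{⊗ n}` formed by the pure tensors of basis vectors. -/
noncomputable def pureTensorBasis (n : ℕ) {L : Type} [Finite L] {V : L → ModuleCat.{u} ℂ}
    {ι : L → Type u} (b : ∀ x, Module.Basis (ι x) ℂ (V x)) :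
    Module.Basis (∀ x, Fin n → ι x) ℂ (⨂[ℂ] x, ⨂[ℂ] _ : Fin n, V x) :=
  Basis.piTensorProduct fun x => Basis.piTensorProduct fun _ => b x

theorem pureTensorBasis_apply {n : ℕ} {L : Type} [Finite L] {V : L → ModuleCat.{u} ℂ}
    {ι : L → Type u} (b : ∀ x, Module.Basis (ι x) ℂ (V x)) (β : ∀ x, Fin n → ι x) :
    pureTensorBasis n b β = pureTensor n V fun x i => b x (β x i) := by
  simp only [pureTensorBasis, Basis.piTensorProduct_apply, pureTensor]

theorem mem_multilinearPart_iff_sum {n : ℕ} {N : Sub (tensorW.{u} n)} {L : Type} [Fintype L]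
    [DecidableEq L] {c : (L → Equiv.Perm (Fin n)) →₀ ℂ} :
    c ∈ multilinearPart N L ↔ ∀ (V : L → ModuleCat.{u} ℂ) (v : ∀ x, Fin n → V x),
      ∑ σ : L → Equiv.Perm (Fin n), c σ • pureTensor n V (fun x i => v x (σ x i)) ∈
        N.obj ⟨L, V⟩ := by
  have h (V : L → ModuleCat.{u} ℂ) (v : ∀ x, Fin n → V x) :
      Finsupp.linearCombination ℂ (fun σ : L → Equiv.Perm (Fin n) =>
        pureTensor n V fun x i => v x (σ x i)) c =
      ∑ σ : L → Equiv.Perm (Fin n), c σ • pureTensor n V fun x i => v x (σ x i) := by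
    rw [Finsupp.linearCombination_apply]
    exact Finsupp.sum_fintype c _ fun _ => zero_smul _ _
  simp only [mem_multilinearPart, h]

/-- The signed sum, over all sets `S` of pairs `(x, k)`, of the tensor powers of the maps that send
a basis vector `b x j` to the sum of the `v x k` with `β₀ x k = j` and `(x, k) ∈ S`. By
inclusion-exclusion it extracts the part that is linear in each `v x k`. -/
theorem sum_map_eq_sum_repr {n : ℕ} {L : Type} [Fintype L] [DecidableEq L]
    {V W : L → ModuleCat.{u} ℂ} {ι : L → Type u} [∀ x, DecidableEq (ι x)]
    (b : ∀ x, Module.Basis (ι x) ℂ (V x)) (β₀ : ∀ x, Fin n → ι x) (v : ∀ x, Fin n → W x)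
    (t : ⨂[ℂ] x, ⨂[ℂ] _ : Fin n, V x) :
    ∑ S : Finset (L × Fin n), (-1 : ℂ) ^ Sᶜ.card •
      PiTensorProduct.map (fun x => PiTensorProduct.map fun _ => (b x).constr ℂ fun j =>
        ∑ k, (if (x, k) ∈ S ∧ β₀ x k = j then (1 : ℂ) else 0) • v x k) t =
      ∑ σ : L → Equiv.Perm (Fin n), (pureTensorBasis n b).repr t (fun x i => β₀ x (σ x i)) •
        pureTensor n W fun x i => v x (σ x i) := by
  let A : (⨂[ℂ] x, ⨂[ℂ] _ : Fin n, V x) →ₗ[ℂ] ⨂[ℂ] x, ⨂[ℂ] _ : Fin n, W x :=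
    ∑ S : Finset (L × Fin n), (-1 : ℂ) ^ Sᶜ.card •
      PiTensorProduct.map (fun x => PiTensorProduct.map fun _ => (b x).constr ℂ fun j =>
        ∑ k, (if (x, k) ∈ S ∧ β₀ x k = j then (1 : ℂ) else 0) • v x k)
  let B : (⨂[ℂ] x, ⨂[ℂ] _ : Fin n, V x) →ₗ[ℂ] ⨂[ℂ] x, ⨂[ℂ] _ : Fin n, W x :=
    ∑ σ : L → Equiv.Perm (Fin n),
      ((pureTensorBasis n b).coord fun x i => β₀ x (σ x i)).smulRight
        (pureTensor n W fun x i => v x (σ x i))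
  suffices h : A = B by
    have := LinearMap.congr_fun h t
    simpa only [A, B, LinearMap.sum_apply, LinearMap.smul_apply, LinearMap.smulRight_apply,
      Module.Basis.coord_apply] using this
  refine (pureTensorBasis n b).ext fun β => ?_
  simp only [A, B, LinearMap.sum_apply, LinearMap.smul_apply, LinearMap.smulRight_apply,
    Module.Basis.coord_apply, Module.Basis.repr_self]
  have hmap (S : Finset (L × Fin n)) :
      PiTensorProduct.map (fun x => PiTensorProduct.map fun _ => (b x).constr ℂ fun j =>
        ∑ k, (if (x, k) ∈ S ∧ β₀ x k = j then (1 : ℂ) else 0) • v x k)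
          (pureTensorBasis n b β) =
        ∑ r : L → Fin n → Fin n,
          (∏ x, ∏ i, (if (x, r x i) ∈ S ∧ β₀ x (r x i) = β x i then (1 : ℂ) else 0)) •
            pureTensor n W fun x i => v x (r x i) := by
    rw [← pureTensor_sum W (fun x i k =>
      if (x, k) ∈ S ∧ β₀ x k = β x i then (1 : ℂ) else 0) v, pureTensorBasis_apply, pureTensor,
      PiTensorProduct.map_tprod]
    simp only [PiTensorProduct.map_tprod, Module.Basis.constr_basis, pureTensor]
  let im (r : L → Fin n → Fin n) : Finset (L × Fin n) :=
    Finset.univ.image fun p : L × Fin n => (p.1, r p.1 p.2)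
  have him (r : L → Fin n → Fin n) : im r = Finset.univ ↔ ∀ x, Function.Surjective (r x) := by
    simp only [im, Finset.eq_univ_iff_forall, Finset.mem_image, Finset.mem_univ, true_and,
      Prod.forall, Prod.exists, Prod.mk.injEq, Function.Surjective]
    constructor
    · rintro h x k
      obtain ⟨_, i, rfl, h⟩ := h x k
      exact ⟨i, h⟩
    · intro h x k
      obtain ⟨i, hi⟩ := h x k
      exact ⟨x, i, rfl, hi⟩
  have hprod (S : Finset (L × Fin n)) (r : L → Fin n → Fin n) :
      (∏ x, ∏ i, (if (x, r x i) ∈ S ∧ β₀ x (r x i) = β x i then (1 : ℂ) else 0)) =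
        if im r ⊆ S ∧ (fun x i => β₀ x (r x i)) = β then 1 else 0 := by
    simp only [Finset.prod_boole, Finset.mem_univ, forall_true_left]
    refine if_congr ?_ rfl rfl
    simp only [im, Finset.image_subset_iff, funext_iff, Finset.mem_univ, forall_true_left,
      Prod.forall, forall_and]
  simp only [hmap, hprod, Finset.smul_sum, smul_smul]
  rw [Finset.sum_comm]
  simp only [← Finset.sum_smul]
  have hsum (r : L → Fin n → Fin n) :
      ∑ S : Finset (L × Fin n), (-1 : ℂ) ^ Sᶜ.card *
        (if im r ⊆ S ∧ (fun x i => β₀ x (r x i)) = β then 1 else 0) =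
      if (∀ x, Function.Surjective (r x)) ∧ (fun x i => β₀ x (r x i)) = β then 1 else 0 := by
    by_cases hβ : (fun x i => β₀ x (r x i)) = β
    · simp only [hβ, and_true, mul_ite, mul_one, mul_zero, sum_neg_one_pow_card_compl, him]
    · simp only [hβ, and_false, if_false, mul_zero, Finset.sum_const_zero]
  simp only [hsum]
  refine (Fintype.sum_of_injective (fun (σ : L → Equiv.Perm (Fin n)) x => ⇑(σ x)) ?_ _ _ ?_ ?_).symm
  · intro σ τ h
    exact funext fun x => Equiv.coe_fn_injective (congrFun h x)
  · intro r hr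
    rw [if_neg, zero_smul]
    rintro ⟨h, -⟩
    exact hr ⟨fun x => Equiv.ofBijective (r x) (Finite.injective_iff_bijective.1
      (Finite.injective_iff_surjective.2 (h x))), rfl⟩
  · intro σ
    congr 1
    rw [Finsupp.single_apply]
    refine if_congr ?_ rfl rfl
    exact ⟨fun h => ⟨fun x => (σ x).surjective, h.symm⟩, fun h => h.2.symm⟩

/-- The coefficients of an element of `N` along a permutation orbit of basis elements belong to the
multilinear part of `N`. -/
theorem repr_mem_multilinearPart {n : ℕ} {N : Sub (tensorW.{u} n)} {L : Type} [Finite L]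
    {V : L → ModuleCat.{u} ℂ} {ι : L → Type u} (b : ∀ x, Module.Basis (ι x) ℂ (V x))
    (β₀ : ∀ x, Fin n → ι x) {t : ⨂[ℂ] x, ⨂[ℂ] _ : Fin n, V x} (ht : t ∈ N.obj ⟨L, V⟩) :
    Finsupp.equivFunOnFinite.symm (fun σ : L → Equiv.Perm (Fin n) =>
      (pureTensorBasis n b).repr t (fun x i => β₀ x (σ x i))) ∈ multilinearPart N L := by
  classical
  have := Fintype.ofFinite L
  refine mem_multilinearPart_iff_sum.2 fun W v => ?_
  refine (congrArg (· ∈ N.obj ⟨L, W⟩) (sum_map_eq_sum_repr b β₀ v t)).mp ?_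
  exact Submodule.sum_mem _ fun S _ => Submodule.smul_mem _ _ (map_mem_of_sub N _ ht)

/-- A subfunctor is determined by its multilinear parts. An element `t` of `N` with coefficients
`t_β` satisfies `∑ β, ∑ σ, t_{β ∘ σ} e_{β ∘ σ} = (n!)^{|L|} t`, and the inner sums come from the
multilinear part. -/
theorem le_of_multilinearPart_le {n : ℕ} {N N' : Sub (tensorW.{u} n)}
    (h : ∀ (L : Type) [Finite L], multilinearPart N L ≤ multilinearPart N' L) : N ≤ N' := by
  classical
  rintro ⟨L, V⟩ (t : ⨂[ℂ] x, ⨂[ℂ] _ : Fin n, V x) ht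
  have := Fintype.ofFinite L
  let b := fun x => Module.Basis.ofVectorSpace ℂ (V x)
  let B := pureTensorBasis n b
  let act (σ : L → Equiv.Perm (Fin n)) := Equiv.piCongrRight fun x =>
    (Equiv.arrowCongr (σ x).symm
      (Equiv.refl (Module.Basis.ofVectorSpaceIndex ℂ (V x))))
  have hinner (β₀) : ∑ σ : L → Equiv.Perm (Fin n), B.repr t (act σ β₀) • B (act σ β₀) ∈
      N'.obj ⟨L, V⟩ := by
    have hc := mem_multilinearPart_iff_sum.1 (h L (repr_mem_multilinearPart b β₀ ht)) V
      fun x i => b x (β₀ x i)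
    simp only [B, pureTensorBasis_apply]
    exact hc
  have hfin : (Function.support fun β => B.repr t β • B β).Finite :=
    (B.repr t).hasFiniteSupport.subset fun β hβ h0 => hβ (by simp only [h0, zero_smul])
  have htotal : ∑ᶠ β, B.repr t β • B β = t := by
    rw [finsum_eq_sum_of_support_subset (s := (B.repr t).support)]
    · exact B.linearCombination_repr t
    · intro β hβ
      simp only [Finset.mem_coe, Finsupp.mem_support_iff]
      exact fun h0 => hβ (by simp only [h0, zero_smul])
  have hsum : ∑ᶠ β₀, ∑ σ : L → Equiv.Perm (Fin n), B.repr t (act σ β₀) • B (act σ β₀) =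
      (Fintype.card (L → Equiv.Perm (Fin n)) : ℂ) • t := by
    rw [finsum_sum_comm]
    · have he (σ) := finsum_comp_equiv (act σ) (f := fun β => B.repr t β • B β)
      simp only [he, htotal, Finset.sum_const, Finset.card_univ, Nat.cast_smul_eq_nsmul]
    · exact fun σ _ => hfin.preimage (act σ).injective.injOn
  have hmem : (Fintype.card (L → Equiv.Perm (Fin n)) : ℂ) • t ∈ N'.obj ⟨L, V⟩ := by
    refine (congrArg (· ∈ N'.obj ⟨L, V⟩) hsum).mp ?_
    exact finsum_induction (· ∈ N'.obj ⟨L, V⟩) (zero_mem _) (fun _ _ => add_mem) hinner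
  exact (Submodule.smul_mem_iff _ (Nat.cast_ne_zero.2 Fintype.card_ne_zero)).1 hmem

/-- A chain of subfunctors stabilizes once its multilinear parts on the sets `Fin m` do. -/
theorem chainCondition_tensorW (n : ℕ) : ChainCondition (tensorW.{u} n) := by
  intro M
  obtain ⟨r, hr⟩ := chain_stabilizes_of_surjective_pullback
    (fun r m => multilinearPart (M r) (Fin m))
    (fun m => (multilinearPart_mono (Fin m)).comp M.monotone)
    (fun r _ _ f hf c hc => mapDomain_mem_multilinearPart hf hc)
  refine ⟨r, fun s hs => le_antisymm (le_of_multilinearPart_le fun L _ c hc => ?_)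
    (M.monotone hs)⟩
  let e := Finite.equivFin L
  have h := mapDomain_mem_multilinearPart e.symm.surjective hc
  rw [hr s hs] at h
  have h' := mapDomain_mem_multilinearPart e.surjective h
  rw [← Finsupp.mapDomain_comp] at h'
  have hid : (fun σ : Fin (Nat.card L) → Equiv.Perm (Fin n) => σ ∘ e) ∘
      (fun σ : L → Equiv.Perm (Fin n) => σ ∘ e.symm) = id := by
    funext σ
    simp [Function.comp_assoc]
  rwa [hid, Finsupp.mapDomain_id] at h'

theorem chainCondition_Phi (n : ℕ) : ChainCondition (DeltaModule.Phi.{u} n).functor :=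
  (chainCondition_tensorW n).of_injective (DeltaModule.phiSub n).incl
    fun _ => Subtype.val_injective

end DeltaMod

/-! ### Freeness -/

namespace DeltaMod

open DeltaModule

/-- The one-member family that consists of the tensor product of the members of `X`. -/
noncomputable def total (X : VecDelta.{u}) : VecF.{u} :=
  ⟨⟨Unit, fun _ => ModuleCat.of ℂ (⨂[ℂ] x, X.V x)⟩⟩

/-- The tensor product over a type, as the tensor product over the fibre of its map to a point. -/
noncomputable def overPoint {L : Type} (V : L → Type u) [∀ x, AddCommGroup (V x)]
    [∀ x, Module ℂ (V x)] : (⨂[ℂ] x, V x) ≃ₗ[ℂ] ⨂[ℂ] y : {_y : L // () = ()}, V y.1 :=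
  PiTensorProduct.reindex ℂ V (Equiv.subtypeUnivEquiv fun _ => rfl).symm

theorem overPoint_tprod {L : Type} (V : L → Type u) [∀ x, AddCommGroup (V x)]
    [∀ x, Module ℂ (V x)] (v : ∀ x, V x) :
    overPoint V (PiTensorProduct.tprod ℂ v) =
      PiTensorProduct.tprod ℂ fun y : {_y : L // () = ()} => v y.1 :=
  PiTensorProduct.reindex_tprod _ v

/-- The morphism from the tensor product of a nonempty family to the family, which is given by the
identity of the tensor product. -/
noncomputable def collapse (X : VecDelta.{u}) [Nonempty X.L] : inclF.obj (total X) ⟶ X :=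
  VecDelta.Hom.mk (X := (total X).obj) (Y := X) (fun _ => ())
    (fun _ => ⟨Classical.arbitrary X.L, rfl⟩) fun _ => (overPoint fun x => X.V x).toLinearMap

/-- The tensor product of families is functorial. -/
noncomputable def total.map {X Y : VecDelta.{u}} (f : X ⟶ Y) : total X ⟶ total Y :=
  ⟨(family Unit).map fun _ => ModuleCat.ofHom (totalMap f), Function.bijective_id⟩

theorem fibreJoin_overPoint {L L' : Type} [Finite L] [Finite L'] (f : L' → L)
    (V : L' → Type u) [∀ y, AddCommGroup (V y)] [∀ y, Module ℂ (V y)]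
    (s : ⨂[ℂ] x, ⨂[ℂ] y : {y // f y = x}, V y.1) :
    fibreJoin (fun _ : L => ()) f V () (overPoint (fun x => ⨂[ℂ] y : {y // f y = x}, V y.1) s) =
      overPoint V (totalJoin f V s) := by
  refine LinearMap.congr_fun (f := fibreJoin (fun _ : L => ()) f V () ∘ₗ
    (overPoint fun x => ⨂[ℂ] y : {y // f y = x}, V y.1).toLinearMap)
    (g := (overPoint V).toLinearMap ∘ₗ totalJoin f V) (total_ext f V ?_) s
  refine PiTensorProduct.ext (MultilinearMap.ext fun v => ?_)
  simp only [LinearMap.compMultilinearMap_apply, LinearMap.comp_apply, LinearEquiv.coe_coe,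
    totalSplit_tprod, totalJoin_tprod, overPoint_tprod]
  exact fibreJoin_tprod (fun _ : L => ()) f V () fun y => v y.1

theorem map_overPoint {L : Type} (V W : L → Type u) [∀ x, AddCommGroup (V x)]
    [∀ x, Module ℂ (V x)] [∀ x, AddCommGroup (W x)] [∀ x, Module ℂ (W x)]
    (φ : ∀ x, V x →ₗ[ℂ] W x) (t : ⨂[ℂ] x, V x) :
    PiTensorProduct.map (fun y : {_y : L // () = ()} => φ y.1) (overPoint V t) =
      overPoint W (PiTensorProduct.map φ t) := by
  refine LinearMap.congr_fun (f := PiTensorProduct.map (fun y : {_y : L // () = ()} => φ y.1) ∘ₗ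
    (overPoint V).toLinearMap) (g := (overPoint W).toLinearMap ∘ₗ PiTensorProduct.map φ) ?_ t
  refine PiTensorProduct.ext (MultilinearMap.ext fun v => ?_)
  simp only [LinearMap.compMultilinearMap_apply, LinearMap.comp_apply, LinearEquiv.coe_coe,
    PiTensorProduct.map_tprod, overPoint_tprod]

theorem collapse_naturality {X Y : VecDelta.{u}} [Nonempty X.L] [Nonempty Y.L] (f : X ⟶ Y) :
    collapse X ≫ f = inclF.map (total.map f) ≫ collapse Y := by
  have key (t : ⨂[ℂ] x, X.V x) : (collapse X ≫ f).maps () t =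
      (inclF.map (total.map f) ≫ collapse Y).maps () t := by
    have h₁ := (congrArg (fibreJoin (fun _ : X.L => ()) f.toFun (fun y => Y.V y) ())
      (map_overPoint (fun x => X.V x) _ f.maps t)).trans
      (fibreJoin_overPoint f.toFun (fun y => Y.V y) (PiTensorProduct.map f.maps t))
    have h₂ := fibreJoin_single_left (fun _ : Y.L => ()) (fun y => Y.V y) ()
        (overPoint (fun y => Y.V y) (totalMap f t))
    have h₃ := (map_single (M := fun _ : Unit => ⨂[ℂ] y, Y.V y)
        (N := fun _ : Unit => ⨂[ℂ] y : {_y : Y.L // () = ()}, Y.V y.1) ()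
        (fun _ => (overPoint fun y => Y.V y).toLinearMap) (totalMap f t))
    refine h₁.trans ?_
    exact h₂.symm.trans (congrArg (fibreJoin (fun _ : Unit => ()) (fun _ : Y.L => ())
      (fun y => Y.V y) ()) h₃).symm
  exact congrArg (VecDelta.Hom.mk (X := (total X).obj) (Y := Y) (fun _ => ())
    (collapse X ≫ f).surjective) (funext fun _ => LinearMap.ext key)
theorem totalMap_collapse_bijective (X : VecDelta.{u}) [Nonempty X.L] :
    Function.Bijective (totalMap (collapse X)) := by
  have h := (PiTensorProduct.congr fun _ : Unit => overPoint fun x => X.V x).bijective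
  exact (splitEquiv (Equiv.sigmaFiberEquiv fun _ : X.L => ()) fun x => X.V x).symm.bijective.comp h

theorem tensorMap_bijective (n : ℕ) {X Y : VecDelta.{u}} {f : X ⟶ Y}
    (hf : Function.Bijective (totalMap f)) : Function.Bijective (tensorMap n f) := by
  have h := (PiTensorProduct.congr fun _ : Fin n => LinearEquiv.ofBijective _ hf).bijective
  exact (swap n fun y => Y.V y).symm.bijective.comp (h.comp (swap n fun x => X.V x).bijective)

theorem isZero_T_obj (n : ℕ) {X : VecF.{u}} (hX : Nat.card X.obj.L ≠ 1) :
    Limits.IsZero ((T.{u} n).obj X) := by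
  refine ModuleCat.isZero_of_iff_subsingleton.2 ⟨fun s t => Subtype.ext ?_⟩
  have h (t : (T.{u} n).obj X) : t.1 = 0 := by
    have := t.2
    simp only [if_neg hX] at this
    exact this
  rw [h s, h t]

theorem isZero_Phi_obj (n : ℕ) {X : VecDelta.{u}} (hX : ¬ Nonempty X.L) :
    Limits.IsZero ((Phi.{u} n).functor.obj X) := by
  refine ModuleCat.isZero_of_iff_subsingleton.2 ⟨fun s t => Subtype.ext ?_⟩
  have h (t : (Phi.{u} n).functor.obj X) : t.1 = 0 := by
    have := t.2
    simp only [phiSub, if_neg hX] at this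
    exact this
  rw [h s, h t]

instance mono_unit_app (n : ℕ) (X : VecF.{u}) : Mono ((unit.{u} n).app X) :=
  (ModuleCat.mono_iff_injective _).2 fun _ _ h =>
    Subtype.ext (congrArg (fun r => r.1) h)

/-- The map `(⨂_x V x)^{⊗ n} → ⨂_x (V x)^{⊗ n}` obtained from the generators of `Φ(T_n)`. -/
noncomputable def fromTotal (n : ℕ) (X : VecDelta.{u}) [Nonempty X.L] :
    (T.{u} n).obj (total X) ⟶ (Phi.{u} n).functor.obj X :=
  (unit n).app (total X) ≫ (Phi n).functor.map (collapse X)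

instance isIso_fromTotal (n : ℕ) (X : VecDelta.{u}) [Nonempty X.L] :
    IsIso (fromTotal n X) := by
  have hb := tensorMap_bijective n (totalMap_collapse_bijective X)
  have he (s) : ((fromTotal n X).hom s).1 = tensorMap n (collapse X) s.1 := rfl
  refine (ConcreteCategory.isIso_iff_bijective _).2 ⟨fun s t h => ?_, fun t => ?_⟩
  · exact Subtype.ext (hb.1 ((he s).symm.trans ((congrArg Subtype.val h).trans (he t))))
  · obtain ⟨s, hs⟩ := hb.2 t.1
    have hcard : Nat.card (total X).obj.L = 1 := Nat.card_unique (α := Unit)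
    refine ⟨⟨s, ?_⟩, Subtype.ext hs⟩
    simp only [if_pos hcard]
    exact Submodule.mem_top

theorem fromTotal_naturality (n : ℕ) {X Y : VecDelta.{u}} [Nonempty X.L] [Nonempty Y.L]
    (f : X ⟶ Y) :
    fromTotal n X ≫ (Phi n).functor.map f = (T n).map (total.map f) ≫ fromTotal n Y := by
  have h := (unit.{u} n).naturality (total.map f)
  rw [fromTotal, fromTotal, Category.assoc, ← Functor.map_comp, collapse_naturality,
    Functor.map_comp, ← Category.assoc, ← Category.assoc, h]
  rfl

open Classical in
/-- The extension of `φ` to `Φ(T_n)`: since `fromTotal` is an isomorphism for nonempty families,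
it is determined by the values of `φ` on families with one member. -/
noncomputable def extend {n : ℕ} {M : VecDelta.{u} ⥤ ModuleCat.{u} ℂ} (φ : T.{u} n ⟶ inclF ⋙ M) :
    (Phi.{u} n).functor ⟶ M where
  app X := if h : Nonempty X.L then
    inv (fromTotal n X) ≫ φ.app (total X) ≫ M.map (collapse X) else 0
  naturality X Y f := by
    by_cases hX : Nonempty X.L
    · have hY : Nonempty Y.L := hX.map fun x => (f.surjective x).choose
      have h : (T n).map (total.map f) ≫ φ.app (total Y) =
        φ.app (total X) ≫ M.map (inclF.map (total.map f)) := φ.naturality (total.map f)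
      rw [dif_pos hX, dif_pos hY, ← cancel_epi (fromTotal n X), Category.assoc, Category.assoc,
        IsIso.hom_inv_id_assoc, ← Functor.map_comp, collapse_naturality, Functor.map_comp,
        ← reassoc_of% h, reassoc_of% (fromTotal_naturality n f), IsIso.hom_inv_id_assoc]
    · exact (isZero_Phi_obj n hX).eq_of_src _ _

theorem extend_app {n : ℕ} {M : VecDelta.{u} ⥤ ModuleCat.{u} ℂ} (φ : T.{u} n ⟶ inclF ⋙ M)
    (X : VecDelta.{u}) [h : Nonempty X.L] :
    (extend φ).app X = inv (fromTotal n X) ≫ φ.app (total X) ≫ M.map (collapse X) :=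
  dif_pos h

theorem isFreeOn_Phi (n : ℕ) : (Phi.{u} n).IsFreeOn (T n) (unit n) := by
  intro M φ
  refine ⟨extend φ, ?_, fun ψ hψ => ?_⟩
  · refine NatTrans.ext (funext fun X => ?_)
    by_cases hX : Nat.card X.obj.L = 1
    · have hne : Nonempty X.obj.L := (Nat.card_pos_iff.1 (hX ▸ Nat.one_pos)).1
      have hsub : Subsingleton X.obj.L := (Nat.card_eq_one_iff_unique.1 hX).1
      -- for a family with one member, `collapse` is a morphism of finite families
      let κ : total X.obj ⟶ X :=
        ⟨collapse X.obj, fun x y _ => Subsingleton.elim x y, (collapse X.obj).surjective⟩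
      let φX : (T n).obj X ⟶ M.functor.obj X.obj := φ.app X
      have h₁ : (T n).map κ ≫ φX = φ.app (total X.obj) ≫ M.functor.map (collapse X.obj) :=
        φ.naturality κ
      let η : (T n).obj X ⟶ (Phi n).functor.obj X.obj := (unit n).app X
      have hη : Mono η := mono_unit_app n X
      have h₂ : (T n).map κ ≫ η = fromTotal n X.obj := (unit n).naturality κ
      have h₃ : η ≫ inv (fromTotal n X.obj) ≫ (T n).map κ = 𝟙 _ := by
        rw [← cancel_mono η, Category.assoc, Category.assoc, h₂, IsIso.inv_hom_id,
          Category.comp_id, Category.id_comp]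
      change η ≫ (extend φ).app X.obj = φX
      rw [extend_app, ← h₁, reassoc_of% h₃]
    · exact (isZero_T_obj n hX).eq_of_src _ _
  · refine NatTrans.ext (funext fun X => ?_)
    by_cases hX : Nonempty X.L
    · rw [extend_app, ← hψ, IsIso.eq_inv_comp, fromTotal, Category.assoc, ψ.naturality]
      rfl
    · exact (isZero_Phi_obj n hX).eq_of_src _ _

end DeltaMod

theorem mainTheorem6 :
    (∀ n : ℕ, 0 < n →
      (DeltaModule.Phi.{u} n).IsFreeOn (DeltaModule.T n) (DeltaModule.unit n) ∧
        (DeltaModule.Phi.{u} n).IsNoetherian) ∧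
      ∀ F : DeltaModule.{u}, F.IsSmall → F.IsNoetherian ∧ F.IsFinitelyGenerated := by
  refine ⟨fun n _ => ⟨DeltaMod.isFreeOn_Phi n, DeltaMod.chainCondition_Phi n⟩, ?_⟩
  rintro F ⟨I, _, n, -, hF⟩
  have h := (DeltaMod.ChainCondition.directSum _ fun i =>
    DeltaMod.chainCondition_Phi (n i)).of_isSubquotient hF
  exact ⟨h, h.exists_finite_span⟩
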